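/- **Setting.** An instance consists of a finite simple graph $G=(V,E)$ embedded combinatorially (the circular order of the incident edges around each vertex is given; $G$ need not be planar) and a finite set $L$ of lines, which are simple paths in $G$. For $e\in E$ let $L_e$ be the set of lines passing through $e$, and let $E'=\{e\in E : |L_e|\ge 2\}$. A *block move* on a sequence exchanges two consecutive nonempty blocks of it. A *solution* gives for each edge $e=uv$ a sequence $\pi^0(e),\dots,\pi^{t(e)}(e)$ of orders of $L_e$, each arising from the preceding one by a block move, where $\pi^0(e)$ is the order close to $u$ and $\pi^{t(e)}(e)$ the order close to $v$. It must be *consistent*: for each vertex $v$ and each edge $e$ at $v$, the order close to $v$ of those lines of $L_e$ that do not end in $v$ equals their combined order on the other edges at $v$, taken in circular order starting after $e$ (so that two lines sharing an edge never cross in a vertex). Its number of *block crossings* is $\sum_{e\in E}t(e)$. A solution is *monotone* if no two lines cross twice. The instance has the *path terminal property* if all lines end at vertices of degree one and no two lines end at the same vertex, and the *path intersection property* if the common vertices and edges of any two distinct lines form a (possibly empty) path. **Theorem.** There is a constant $c>0$ such that for every prime power $q$ there is an instance with the path terminal and path intersection properties, on a non-planar graph $G$, with $|L|=|E'|=q^2+q+1$,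 in which every (not necessarily monotone) solution has at least $c\,|L|\sqrt{|E'|}$ block crossings. Moreover, the instance can be chosen so that each line contains exactly $q+1$ edges of $E'$ and any two distinct edges of $E'$ lie together on exactly one line (that is, the lines form a Steiner system $S(q^2+q+1,q+1,2)$ on $E'$), and so that there is a monotone solution with at most $|L|\sqrt{|E'|}$ block crossings. In particular, there is an infinite family of non-planar graphs with line sets on which $\Omega(|L|\sqrt{|E'|})$ block crossings are necessary in any solution, and the general upper bound $O(|L|\sqrt{|E'|})$ is asymptotically tight. -/

import Mathlib

/-- A combinatorial embedding of a graph: the clockwise cyclic order of the edges around each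
vertex, given as a permutation of the darts (`next d` is the clockwise successor of `d` around
the vertex `d.fst`) that acts as one single cycle on the darts leaving any given vertex. -/
structure RotationSystem {V : Type*} (G : SimpleGraph V) where
  next : Equiv.Perm G.Dart
  next_fst : ∀ d, (next d).fst = d.fst
  sameCycle : ∀ d d' : G.Dart, d.fst = d'.fst → next.SameCycle d d'

namespace RotationSystem

variable {V : Type*} {G : SimpleGraph V}

/-- The darts at the vertex `d.fst` other than `d` itself, in clockwise order, starting with the
clockwise successor of `d`. -/
noncomputable def others (R : RotationSystem G) (d : G.Dart) : List G.Dart :=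
  (List.range ((G.neighborSet d.fst).ncard - 1)).map fun i => (R.next ^ (i + 1)) d

/-- The face permutation: traverse a dart, then turn to the next dart around its head. -/
def facePerm (R : RotationSystem G) : Equiv.Perm G.Dart :=
  (SimpleGraph.Dart.symm_involutive (G := G)).toPerm.trans R.next

/-- The number of facial walks (cycles of the face permutation, fixed points included). -/
noncomputable def numFaces (R : RotationSystem G) : ℕ :=
  Nat.card (Quotient (Equiv.Perm.SameCycle.setoid R.facePerm))

/-- The embedding has genus zero, for a finite graph: Euler's formula `v - e + f = 2` holds,
summed over all connected components. An isolated vertex has no dart, so its single face is added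
by hand. -/
def IsPlanar (R : RotationSystem G) : Prop :=
  Nat.card V + (R.numFaces + {v : V | G.neighborSet v = ∅}.ncard)
    = G.edgeSet.ncard + 2 * Nat.card G.ConnectedComponent

end RotationSystem

/-- A finite graph is planar if it has a combinatorial embedding of genus zero. -/
def IsPlanarGraph {V : Type*} (G : SimpleGraph V) : Prop :=
  ∃ R : RotationSystem G, R.IsPlanar

/-- `BlockMove x y`: the sequence `y` arises from `x` by exchanging two consecutive nonempty
blocks. -/
def BlockMove {L : Type*} (x y : List L) : Prop :=
  ∃ a b c d : List L, b ≠ [] ∧ c ≠ [] ∧ x = a ++ b ++ c ++ d ∧ y = a ++ c ++ b ++ d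

/-- An embedded graph on the vertex set `V` together with lines, i.e. simple paths in the graph,
indexed by `L`. -/
structure LineNetwork (V L : Type*) where
  graph : SimpleGraph V
  rot : RotationSystem graph
  src : L → V
  tgt : L → V
  line : ∀ l, graph.Walk (src l) (tgt l)
  isPath : ∀ l, (line l).IsPath

namespace LineNetwork

variable {V L : Type*}

/-- The set `L_e` of lines passing through the edge `e`. -/
def linesOn (M : LineNetwork V L) (e : Sym2 V) : Set L :=
  {l | e ∈ (M.line l).edges}

/-- The set `E'` of edges with at least two lines on them. -/
def multiEdges (M : LineNetwork V L) : Set (Sym2 V) :=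
  {e | e ∈ M.graph.edgeSet ∧ (M.linesOn e).Nontrivial}

/-- Path terminal property: lines terminate at nodes of degree one, and every node is the terminal
of at most one line (and at only one end of it). -/
def PathTerminal (M : LineNetwork V L) : Prop :=
  (∀ l, (M.graph.neighborSet (M.src l)).ncard = 1 ∧ (M.graph.neighborSet (M.tgt l)).ncard = 1) ∧
    Function.Injective (Sum.elim M.src M.tgt)

/-- Path intersection property: the common vertices and edges of two distinct lines form a
(possibly empty) path. -/
def PathIntersection (M : LineNetwork V L) : Prop :=
  ∀ l l' : L, l ≠ l' →
    (∀ x, ¬ (x ∈ (M.line l).support ∧ x ∈ (M.line l').support)) ∨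
    ∃ (u v : V) (p : M.graph.Walk u v), p.IsPath ∧
      (∀ x, x ∈ p.support ↔ x ∈ (M.line l).support ∧ x ∈ (M.line l').support) ∧
      (∀ e, e ∈ p.edges ↔ e ∈ (M.line l).edges ∧ e ∈ (M.line l').edges)

/-- Line orders on all edges. On an edge `e` traversed along its dart `d` from `u` to `v`,
`ord d 0, …, ord d (t e)` are the successive orders of `L_e`, read from left to right when
looking from `u` to `v`; so `ord d 0` is the order close to `u` and `ord d (t e)` the one close
to `v`. Seen along the opposite dart, the sequence is traversed backwards and every order is
mirrored. Only values `t e` at edges and `ord d i` with `i ≤ t d.edge` are relevant. -/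
structure LineOrders (M : LineNetwork V L) where
  t : Sym2 V → ℕ
  ord : M.graph.Dart → ℕ → List L
  nodup : ∀ d i, i ≤ t d.edge → (ord d i).Nodup
  mem_iff : ∀ d i, i ≤ t d.edge → ∀ l, l ∈ ord d i ↔ l ∈ M.linesOn d.edge
  move : ∀ d i, i < t d.edge → BlockMove (ord d i) (ord d (i + 1))
  ord_symm : ∀ d i, i ≤ t d.edge → ord d.symm i = (ord d (t d.edge - i)).reverse

namespace LineOrders

variable {M : LineNetwork V L}

open Classical in
/-- Consistency of the line orders in all nodes. For each edge `e` at a node `v`, given by the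
dart `d` leaving `v`: the lines of `L_e` that do not end in `v`, in their order on `e` close
to `v` (read from left to right when looking towards `v`), appear in the same order on the
other edges at `v`, taken clockwise, starting after `e`. -/
def Consistent (S : LineOrders M) : Prop :=
  ∀ d : M.graph.Dart,
    (S.ord d 0).reverse.filter (fun l => M.src l ≠ d.fst ∧ M.tgt l ≠ d.fst) =
      (M.rot.others d).flatMap fun d' => (S.ord d' 0).filter (fun l => l ∈ M.linesOn d.edge)

/-- The total number of block crossings, `∑ t e` over all edges `e`. -/
noncomputable def blockCrossings (S : LineOrders M) : ℕ :=
  ∑ᶠ e ∈ M.graph.edgeSet, S.t e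

/-- The lines `l` and `l'` exchange their relative order in the `i`-th block move along `d`. -/
def Crosses (S : LineOrders M) (l l' : L) (d : M.graph.Dart) (i : ℕ) : Prop :=
  i < S.t d.edge ∧
    (([l, l'].Sublist (S.ord d i) ∧ [l', l].Sublist (S.ord d (i + 1))) ∨
      ([l', l].Sublist (S.ord d i) ∧ [l, l'].Sublist (S.ord d (i + 1))))

/-- No two lines cross twice. -/
def Monotone (S : LineOrders M) : Prop :=
  ∀ l l' : L, l ≠ l' → ∀ d i d' i', S.Crosses l l' d i → S.Crosses l l' d' i' →
    d.edge = d'.edge ∧ (d = d' → i = i')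

end LineOrders

end LineNetwork

/-! The instance is built from a projective plane of order q. Every point p is split into two
vertices `inn p` and `out p` joined by a twin edge, and every line of the plane becomes a path that
runs through the twin edges of its q + 1 points in turn, between two private terminals. Two points
determine a line, so every other edge carries a single line and E' consists of the twin edges
(`multiEdges_eq`). Two lines meet in one point, so two paths share exactly one twin edge
(`pathIntersection`). The Steiner property is the incidence geometry of the plane.

Lower bound: the rotation system lists the q + 1 lines through p in the same clockwise order at `inn
p` and at `out p`. Seen along the twin edge these orders are mirror images, so consistency forces
every solution to reverse all q + 1 lines there (`ord_reverse_of_consistent`). A block move destroys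
at most three adjacencies, hence a reversal needs at least q / 3 moves
(`length_le_of_blockMoves_reverse`, `le_three_mul_t`). Summing over the q² + q + 1 points gives the
bound, because √(q² + q + 1) lies between q and 2q. Conversely, q moves reverse q + 1 lines by
bringing them to the front one at a time, and each pair is exchanged only once (`solution`,
`monotone_solution`).

Nonplanarity: the terminals are leaves, and without them a bipartite core remains with 2|P| vertices
and at least (q + 1)|P| edges. Every face of an embedding has at least four core darts
(`exists_four_sameCycle`), so Euler's formula would bound the number of core edges by 4|P| - 4,
which is false for q ≥ 3. For q = 2 this count does not suffice. There the points on the lines of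
the Fano plane are ordered so that few core edges lie on four-cycles. A face yields either six core
darts or four darts on such edges (`exists_six_sameCycle`), and giving weight 3 to the edges on
four-cycles and 2 to the others bounds the number of faces sharply enough
(`not_isPlanarGraph_of_isQuad`). -/

/-! ### Block moves on lists: the cost of a reversal and an explicit reversal. -/

section Lists

variable {α : Type*}

/-- The number of consecutive pairs of a list that satisfy the relation `r`. -/
noncomputable def List.countSteps (r : α → α → Prop) : List α → ℕ
  | [] => 0
  | [_] => 0
  | a :: b :: l => (open Classical in if r a b then 1 else 0) + countSteps r (b :: l)

theorem List.le_countSteps_append (r : α → α → Prop) (x y : List α) :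
    x.countSteps r + y.countSteps r ≤ (x ++ y).countSteps r := by
  induction x with
  | nil => simp [countSteps]
  | cons a x ih =>
    cases x with
    | nil => cases y <;> simp [countSteps]
    | cons b x =>
      simp only [List.cons_append, countSteps] at ih ⊢
      omega

/-- Concatenation creates only one new consecutive pair, the one at the seam. Together with the
reverse estimate this lets a block move be analysed by its three seams. -/
theorem List.countSteps_append_le (r : α → α → Prop) (x y : List α) :
    (x ++ y).countSteps r ≤ x.countSteps r + y.countSteps r + 1 := by
  induction x with
  | nil => simp [countSteps]
  | cons a x ih =>
    cases x with
    | nil =>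
      cases y with
      | nil => simp [countSteps]
      | cons b y =>
        simp only [List.cons_append, List.nil_append, countSteps]
        split_ifs <;> omega
    | cons b x =>
      simp only [List.cons_append, countSteps] at ih ⊢
      omega

/-- A block move breaks at most three consecutive pairs. -/
theorem BlockMove.countSteps_le (r : α → α → Prop) {x y : List α} (h : BlockMove x y) :
    x.countSteps r ≤ y.countSteps r + 3 := by
  obtain ⟨a, b, c, d, -, -, rfl, rfl⟩ := h
  have h1 := List.countSteps_append_le r (a ++ b ++ c) d
  have h2 := List.countSteps_append_le r (a ++ b) c
  have h3 := List.countSteps_append_le r a b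
  have h4 := List.le_countSteps_append r (a ++ c ++ b) d
  have h5 := List.le_countSteps_append r (a ++ c) b
  have h6 := List.le_countSteps_append r a c
  omega

theorem List.countSteps_eq_zero {r : α → α → Prop} {x : List α}
    (h : x.Pairwise fun a b => ¬ r a b) : x.countSteps r = 0 := by
  induction x with
  | nil => rfl
  | cons a x ih =>
    cases x with
    | nil => rfl
    | cons b x =>
      have := ih h.of_cons
      simp_all [countSteps]

theorem List.countSteps_of_pairwise {r : α → α → Prop} {x : List α}
    (h : x.Pairwise r) : x.countSteps r = x.length - 1 := by
  induction x with
  | nil => rfl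
  | cons a x ih =>
    cases x with
    | nil => rfl
    | cons b x =>
      have := ih h.of_cons
      simp_all [countSteps, add_comm]

/-- Reversing a list of length `n` takes at least `(n - 1) / 3` block moves. -/
theorem length_le_of_blockMoves_reverse {x : List α} (hx : x.Nodup) (s : ℕ → List α) (t : ℕ)
    (h0 : s 0 = x.reverse) (ht : s t = x) (hs : ∀ i < t, BlockMove (s i) (s (i + 1))) :
    x.length ≤ 3 * t + 1 := by
  classical
  -- The potential counts descents with respect to `x`: none in `x`, and all `x.length - 1`
  -- consecutive pairs in the reversed list.
  let r : α → α → Prop := fun a b => x.idxOf b < x.idxOf a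
  have hidx : x.Pairwise fun a b => x.idxOf a < x.idxOf b := by
    rw [List.pairwise_iff_getElem]
    intro i j hi hj hij
    rwa [hx.idxOf_getElem, hx.idxOf_getElem]
  have hx0 : x.countSteps r = 0 :=
    List.countSteps_eq_zero (hidx.imp fun h => not_lt.2 h.le)
  have hxr : x.reverse.countSteps r = x.length - 1 := by
    rw [List.countSteps_of_pairwise (List.pairwise_reverse.2 hidx), List.length_reverse]
  have key : ∀ i ≤ t, (s 0).countSteps r ≤ (s i).countSteps r + 3 * i := by
    intro i
    induction i with
    | zero => simp
    | succ i ih =>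
      intro hi
      have h1 := ih (by omega)
      have h2 := (hs i (by omega)).countSteps_le r
      omega
  have := key t le_rfl
  rw [h0, ht, hx0, hxr] at this
  omega

/-- Intermediate stages of reversing a list by moving its entries to the front one by one. -/
def List.reverseStage (x : List α) (i : ℕ) : List α :=
  (x.take (i + 1)).reverse ++ x.drop (i + 1)

theorem List.reverseStage_perm (x : List α) (i : ℕ) : (x.reverseStage i).Perm x := by
  have := (List.reverse_perm (x.take (i + 1))).append_right (x.drop (i + 1))
  rwa [List.take_append_drop] at this

theorem List.reverseStage_zero (x : List α) : x.reverseStage 0 = x := by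
  cases x <;> simp [reverseStage]

theorem List.reverseStage_of_length_le {x : List α} {i : ℕ} (h : x.length ≤ i + 1) :
    x.reverseStage i = x.reverse := by
  simp [reverseStage, List.take_of_length_le h, List.drop_of_length_le h]

theorem List.reverseStage_succ {x : List α} {i : ℕ} (h : i + 1 < x.length) :
    x.reverseStage (i + 1) = x[i + 1] :: ((x.take (i + 1)).reverse ++ x.drop (i + 2)) := by
  rw [reverseStage, List.take_succ_eq_append_getElem h, List.reverse_append]
  rfl

theorem List.reverseStage_eq {x : List α} {i : ℕ} (h : i + 1 < x.length) :
    x.reverseStage i = (x.take (i + 1)).reverse ++ x[i + 1] :: x.drop (i + 2) := by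
  rw [reverseStage, List.drop_eq_getElem_cons h]

/-- The exchanged blocks are the prefix that is already reversed and the single next entry. -/
theorem List.blockMove_reverseStage {x : List α} {i : ℕ} (h : i + 1 < x.length) :
    BlockMove (x.reverseStage i) (x.reverseStage (i + 1)) := by
  refine ⟨[], (x.take (i + 1)).reverse, [x[i + 1]], x.drop (i + 2), ?_, by simp, ?_, ?_⟩
  · cases x <;> simp at h ⊢
  · simp [List.reverseStage_eq h]
  · simp [List.reverseStage_succ h]

theorem BlockMove.reverse {x y : List α} (h : BlockMove x y) :
    BlockMove y.reverse x.reverse := by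
  obtain ⟨a, b, c, d, hb, hc, rfl, rfl⟩ := h
  exact ⟨d.reverse, b.reverse, c.reverse, a.reverse, by simpa, by simpa, by simp, by simp⟩

theorem List.flatMap_eq_of_forall_ne {β : Type*} {x : List α} (hx : x.Nodup) {a : α}
    (ha : a ∈ x) (f : α → List β) (hf : ∀ b ∈ x, b ≠ a → f b = []) : x.flatMap f = f a := by
  obtain ⟨y, z, rfl⟩ := List.append_of_mem ha
  have hd := List.nodup_append.1 hx
  have hy : y.flatMap f = [] := by
    rw [List.flatMap_eq_nil_iff]
    intro b hb
    exact hf b (by simp [hb]) (hd.2.2 b hb a (by simp))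
  have hz : z.flatMap f = [] := by
    rw [List.flatMap_eq_nil_iff]
    intro b hb
    refine hf b (by simp [hb]) ?_
    rintro rfl
    exact (List.nodup_cons.1 hd.2.1).1 hb
  simp [hy, hz]

theorem List.Nodup.not_sublist_swap {x : List α} (hx : x.Nodup) {a b : α}
    (h : [a, b].Sublist x) (h' : [b, a].Sublist x) : False := by
  classical
  have h1 : ∀ {a b : α}, [a, b].Sublist x → x.idxOf a < x.idxOf b := by
    intro a b h
    have hidx : x.Pairwise fun a b => x.idxOf a < x.idxOf b := by
      rw [List.pairwise_iff_getElem]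
      intro i j hi hj hij
      rwa [hx.idxOf_getElem, hx.idxOf_getElem]
    simpa using hidx.sublist h
  exact absurd (h1 h) (h1 h').not_gt

end Lists

/-- This step only moves the entry `c` of index `i + 1` in front of the entries of smaller index, so
an exchanged pair consists of `c` and an earlier entry. The pair thus determines the step, which is
the source of monotonicity. -/
theorem List.Nodup.max_idxOf_of_swap_reverseStage {α : Type*} [DecidableEq α] {x : List α}
    (hx : x.Nodup) {i : ℕ} (h : i + 1 < x.length) {a b : α} (hab : a ≠ b)
    (h1 : [a, b].Sublist (x.reverseStage i)) (h2 : [b, a].Sublist (x.reverseStage (i + 1))) :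
    i + 1 = max (x.idxOf a) (x.idxOf b) := by
  have hn1 : (x.reverseStage i).Nodup := (x.reverseStage_perm i).nodup_iff.2 hx
  have hn2 : (x.reverseStage (i + 1)).Nodup := (x.reverseStage_perm (i + 1)).nodup_iff.2 hx
  have e1 := List.reverseStage_eq h
  have e2 := List.reverseStage_succ h
  have hidx : x.idxOf x[i + 1] = i + 1 := hx.idxOf_getElem _ _
  set c := x[i + 1] with hc
  have hnb : b ≠ a := hab.symm
  -- If `a = c`, then `a` is first after the move and cannot follow `b`. If `b = c`, then `a` must
  -- come from the prefix. If neither is `c`, deleting `c` makes the two stages equal.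
  by_cases hac : a = c
  · exfalso
    have hb : b ∈ (x.take (i + 1)).reverse ++ x.drop (i + 2) := by
      have : b ∈ x.reverseStage (i + 1) := h2.subset (by simp)
      rw [e2, ← hac] at this
      exact (List.mem_cons.1 this).resolve_left hnb
    refine hn2.not_sublist_swap h2 ?_
    rw [e2, ← hac]
    exact (List.singleton_sublist.2 hb).cons_cons a
  by_cases hbc : b = c
  · have ha : a ∈ x.take (i + 1) := by
      have : a ∈ x.reverseStage i := h1.subset (by simp)
      rw [e1, List.mem_append, List.mem_reverse, List.mem_cons] at this
      obtain h | h | h := this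
      · exact h
      · exact absurd h hac
      · exfalso
        refine hn1.not_sublist_swap h1 ?_
        rw [e1, ← hbc]
        exact ((List.singleton_sublist.2 h).cons_cons b).trans (List.sublist_append_right _ _)
    have := List.idxOf_lt_length_of_mem ha
    rw [List.length_take] at this
    have h3 : x.idxOf a = (x.take (i + 1)).idxOf a := by
      conv_lhs => rw [← List.take_append_drop (i + 1) x]
      exact List.idxOf_append_of_mem ha
    rw [hbc, hidx]
    omega
  · exfalso
    have f1 := h1.filter (· ≠ c)
    have f2 := h2.filter (· ≠ c)
    have : (x.reverseStage i).filter (· ≠ c) = (x.reverseStage (i + 1)).filter (· ≠ c) := by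
      rw [e1, e2]
      simp
    rw [← this] at f2
    simp only [ne_eq, decide_not, List.filter_cons, hac, hbc, decide_false, Bool.not_false,
      if_true, List.filter_nil] at f1 f2
    exact (hn1.filter _).not_sublist_swap f1 f2

/-! ### Rotation systems given by enumerated neighbours. -/

namespace RotationSystem

open scoped Fin.CommRing

variable {V : Type*} {G : SimpleGraph V}

/-- The darts of a graph in terms of an enumeration of the neighbours of every vertex. -/
noncomputable def dartEquiv (deg : V → ℕ) (nb : V → ℕ → V)
    (adj : ∀ v i, i ≤ deg v → G.Adj v (nb v i))
    (inj : ∀ v i j, i ≤ deg v → j ≤ deg v → nb v i = nb v j → i = j)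
    (surj : ∀ v w, G.Adj v w → ∃ i ≤ deg v, nb v i = w) :
    (Σ v, Fin (deg v + 1)) ≃ G.Dart :=
  Equiv.ofBijective (fun x => ⟨(x.1, nb x.1 x.2), adj x.1 x.2 (Nat.lt_succ_iff.1 x.2.2)⟩) <| by
    constructor
    · rintro ⟨v, i⟩ ⟨w, j⟩ h
      simp only [SimpleGraph.Dart.mk.injEq, Prod.mk.injEq] at h
      obtain ⟨rfl, h⟩ := h
      have := inj v i j (Nat.lt_succ_iff.1 i.2) (Nat.lt_succ_iff.1 j.2) h
      rw [Fin.ext this]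
    · rintro ⟨⟨v, w⟩, h⟩
      obtain ⟨i, hi, rfl⟩ := surj v w h
      exact ⟨⟨v, ⟨i, Nat.lt_succ_iff.2 hi⟩⟩, rfl⟩

/-- The rotation system in which the neighbours of `v` are `nb v 0, …, nb v (deg v)` in clockwise
order. -/
noncomputable def ofNeighbors (deg : V → ℕ) (nb : V → ℕ → V)
    (adj : ∀ v i, i ≤ deg v → G.Adj v (nb v i))
    (inj : ∀ v i j, i ≤ deg v → j ≤ deg v → nb v i = nb v j → i = j)
    (surj : ∀ v w, G.Adj v w → ∃ i ≤ deg v, nb v i = w) : RotationSystem G where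
  next := ((dartEquiv deg nb adj inj surj).symm.trans
    (Equiv.sigmaCongrRight fun v => Equiv.addRight (1 : Fin (deg v + 1)))).trans
      (dartEquiv deg nb adj inj surj)
  next_fst d := by
    obtain ⟨x, rfl⟩ := (dartEquiv deg nb adj inj surj).surjective d
    simp only [Equiv.trans_apply, Equiv.symm_apply_apply]
    rfl
  sameCycle d d' h := by
    obtain ⟨⟨v, i⟩, rfl⟩ := (dartEquiv deg nb adj inj surj).surjective d
    obtain ⟨⟨w, j⟩, rfl⟩ := (dartEquiv deg nb adj inj surj).surjective d'
    obtain rfl : v = w := h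
    have key : ∀ k : ℕ, ((((dartEquiv deg nb adj inj surj).symm.trans
        (Equiv.sigmaCongrRight fun v => Equiv.addRight (1 : Fin (deg v + 1)))).trans
        (dartEquiv deg nb adj inj surj) : Equiv.Perm G.Dart) ^ k)
          (dartEquiv deg nb adj inj surj ⟨v, i⟩) =
        dartEquiv deg nb adj inj surj ⟨v, i + (k : Fin (deg v + 1))⟩ := by
      intro k
      induction k with
      | zero => simp
      | succ k ih =>
        rw [pow_succ', Equiv.Perm.mul_apply, ih]
        simp [add_assoc]
    refine ⟨((j - i : Fin (deg v + 1)) : ℕ), ?_⟩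
    rw [zpow_natCast, key]
    simp

section

variable (deg : V → ℕ) (nb : V → ℕ → V)
    (adj : ∀ v i, i ≤ deg v → G.Adj v (nb v i))
    (inj : ∀ v i j, i ≤ deg v → j ≤ deg v → nb v i = nb v j → i = j)
    (surj : ∀ v w, G.Adj v w → ∃ i ≤ deg v, nb v i = w)

theorem ofNeighbors_next_pow (v : V) (i : Fin (deg v + 1)) (k : ℕ) :
    ((ofNeighbors deg nb adj inj surj).next ^ k) (dartEquiv deg nb adj inj surj ⟨v, i⟩) =
      dartEquiv deg nb adj inj surj ⟨v, i + (k : Fin (deg v + 1))⟩ := by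
  induction k with
  | zero => simp
  | succ k ih =>
    rw [pow_succ', Equiv.Perm.mul_apply, ih]
    simp [ofNeighbors, add_assoc]

include adj inj surj in
theorem ncard_neighborSet_of_neighbors (v : V) : (G.neighborSet v).ncard = deg v + 1 := by
  have : G.neighborSet v = nb v '' (Finset.range (deg v + 1) : Set ℕ) := by
    ext w
    simp only [SimpleGraph.mem_neighborSet, Finset.coe_range, Set.mem_image, Set.mem_Iio,
      Nat.lt_succ_iff]
    exact ⟨surj v w, by rintro ⟨i, hi, rfl⟩; exact adj v i hi⟩
  rw [this, Set.InjOn.ncard_image, Set.ncard_coe_finset, Finset.card_range]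
  intro i hi j hj h
  simp only [Finset.coe_range, Set.mem_Iio, Nat.lt_succ_iff] at hi hj
  exact inj v i j hi hj h

theorem ofNeighbors_others (v : V) (i : Fin (deg v + 1)) :
    (ofNeighbors deg nb adj inj surj).others (dartEquiv deg nb adj inj surj ⟨v, i⟩) =
      (List.range (deg v)).map fun k =>
        dartEquiv deg nb adj inj surj ⟨v, i + ((k + 1 : ℕ) : Fin (deg v + 1))⟩ := by
  have h : (G.neighborSet (dartEquiv deg nb adj inj surj ⟨v, i⟩).fst).ncard = deg v + 1 :=
    ncard_neighborSet_of_neighbors deg nb adj inj surj v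
  rw [others, h]
  simp only [ofNeighbors_next_pow, Nat.add_sub_cancel]

/-- Starting from neighbour 0 there is no wrap-around, so the circular order is the enumeration
itself. In the network, neighbour 0 of a point vertex is its twin. -/
theorem ofNeighbors_others_toProd (d : G.Dart) (hd : d.snd = nb d.fst 0) :
    ((ofNeighbors deg nb adj inj surj).others d).map (fun d' => d'.toProd) =
      (List.range (deg d.fst)).map fun k => (d.fst, nb d.fst (k + 1)) := by
  have h : d = dartEquiv deg nb adj inj surj ⟨d.fst, 0⟩ := by
    ext
    · rfl
    · exact hd
  generalize d.fst = v at h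
  subst h
  rw [ofNeighbors_others, List.map_map]
  refine List.map_congr_left fun k hk => ?_
  simp only [List.mem_range] at hk
  replace hk : k < deg v := hk
  have : ((k + 1 : ℕ) : Fin (deg v + 1)).val = k + 1 := by
    rw [Fin.val_natCast, Nat.mod_eq_of_lt (by omega)]
  change (v, nb v (0 + ((k + 1 : ℕ) : Fin (deg v + 1))).val) = (v, nb v (k + 1))
  rw [zero_add, this]

theorem ofNeighbors_others_nodup (d : G.Dart) :
    ((ofNeighbors deg nb adj inj surj).others d).Nodup := by
  obtain ⟨⟨v, i⟩, rfl⟩ := (dartEquiv deg nb adj inj surj).surjective d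
  rw [ofNeighbors_others]
  refine List.Nodup.map_on ?_ List.nodup_range
  intro k hk m hm h
  simp only [List.mem_range] at hk hm
  have := (dartEquiv deg nb adj inj surj).injective h
  simp only [Sigma.mk.injEq, heq_eq_eq, true_and, add_right_inj] at this
  have := congrArg Fin.val this
  rw [Fin.val_natCast, Fin.val_natCast, Nat.mod_eq_of_lt (by omega),
    Nat.mod_eq_of_lt (by omega)] at this
  omega

theorem mem_ofNeighbors_others (d d' : G.Dart) :
    d' ∈ (ofNeighbors deg nb adj inj surj).others d ↔ d'.fst = d.fst ∧ d' ≠ d := by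
  obtain ⟨⟨v, i⟩, rfl⟩ := (dartEquiv deg nb adj inj surj).surjective d
  obtain ⟨⟨w, j⟩, rfl⟩ := (dartEquiv deg nb adj inj surj).surjective d'
  rw [ofNeighbors_others]
  simp only [List.mem_map, List.mem_range, EmbeddingLike.apply_eq_iff_eq, ne_eq]
  constructor
  · rintro ⟨k, hk, h⟩
    rw [Sigma.mk.injEq] at h
    obtain ⟨rfl, h⟩ := h
    obtain rfl := eq_of_heq h
    refine ⟨rfl, ?_⟩
    intro h
    simp only [Sigma.mk.injEq, heq_eq_eq, true_and, add_eq_left] at h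
    have := congrArg Fin.val h
    rw [Fin.val_natCast, Nat.mod_eq_of_lt (by omega)] at this
    simp at this
  · rintro ⟨h, hne⟩
    obtain rfl : w = v := h
    have hji : j ≠ i := fun h => hne (by rw [h])
    have h0 : ((j - i : Fin (deg w + 1)) : ℕ) ≠ 0 := by
      intro h
      exact hji (sub_eq_zero.1 (Fin.ext h))
    refine ⟨((j - i : Fin (deg w + 1)) : ℕ) - 1, by omega, ?_⟩
    rw [Nat.sub_add_cancel (by omega)]
    simp

end

end RotationSystem

/-! ### Faces of a graph whose vertices outside a core `C` are leaves. -/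

namespace RotationSystem

variable {V : Type*} {G : SimpleGraph V} (R : RotationSystem G)

/-- A dart both of whose ends lie in the vertex set `C`. -/
def IsInner (C : Set V) (d : G.Dart) : Prop := d.fst ∈ C ∧ d.snd ∈ C

theorem IsInner.symm {C : Set V} {d : G.Dart} (h : IsInner C d) : IsInner C d.symm :=
  ⟨h.2, h.1⟩

theorem facePerm_apply (d : G.Dart) : R.facePerm d = R.next d.symm := rfl

theorem next_pow_fst (k : ℕ) (d : G.Dart) : ((R.next ^ k) d).fst = d.fst := by
  induction k with
  | zero => rfl
  | succ k ih => rw [pow_succ', Equiv.Perm.mul_apply, R.next_fst, ih]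

variable {R} {C : Set V}
  (leaf : ∀ d d' : G.Dart, d.fst ∉ C → d.fst = d'.fst → d = d')

include leaf

/-- A vertex outside of `C` has a single dart, so a face that arrives there must turn back. -/
theorem facePerm_of_snd_notMem {d : G.Dart} (hd : d.snd ∉ C) : R.facePerm d = d.symm :=
  leaf _ _ (by rw [facePerm_apply, R.next_fst]; exact hd)
    (by rw [facePerm_apply, R.next_fst])

/-- When a face enters a vertex of `C`, it leaves it through an inner dart, possibly after
excursions to vertices outside of `C`. It only turns back if there is no other inner dart. -/
theorem exists_sameCycle_facePerm [Finite V] (d y : G.Dart) (hy : IsInner C y)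
    (hyd : y.fst = d.snd) :
    ∃ d' : G.Dart, IsInner C d' ∧ d'.fst = d.snd ∧ R.facePerm.SameCycle d d' ∧
      (d' = d.symm → ∀ z : G.Dart, IsInner C z → z.fst = d.snd → z = d.symm) := by
  classical
  have : Finite G.Dart := Finite.of_injective _ SimpleGraph.Dart.toProd_injective
  have reach : ∀ z : G.Dart, z.fst = d.snd → ∃ n, (R.next ^ (n + 1)) d.symm = z := by
    intro z hz
    obtain ⟨n, hn, -, h⟩ := (R.sameCycle d.symm z hz.symm).exists_pow_eq''
    exact ⟨n - 1, by rwa [Nat.sub_add_cancel hn]⟩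
  have hex : ∃ i, IsInner C ((R.next ^ (i + 1)) d.symm) := by
    obtain ⟨n, rfl⟩ := reach y hyd
    exact ⟨n, hy⟩
  -- The first inner dart met when rotating around the head of `d` is the one through which the face
  -- leaves.
  let i := Nat.find hex
  have hi : IsInner C ((R.next ^ (i + 1)) d.symm) := Nat.find_spec hex
  have hmin : ∀ j < i, ¬ IsInner C ((R.next ^ (j + 1)) d.symm) := fun j hj => Nat.find_min hex hj
  have hv : d.snd ∈ C := hyd ▸ hy.1
  have walk : ∀ j ≤ i, R.facePerm.SameCycle d ((R.next ^ (j + 1)) d.symm) := by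
    intro j
    induction j with
    | zero =>
      intro _
      exact ⟨1, by simp [facePerm_apply]⟩
    | succ j ih =>
      intro hj
      have h1 := ih (by omega)
      have h2 : ((R.next ^ (j + 1)) d.symm).snd ∉ C := fun h =>
        hmin j (by omega) ⟨by rw [next_pow_fst]; exact hv, h⟩
      -- An excursion to a leaf and back takes two face steps and advances the rotation by one dart.
      refine h1.trans ⟨2, ?_⟩
      have h3 := facePerm_of_snd_notMem (R := R) leaf h2
      rw [zpow_ofNat, pow_two, Equiv.Perm.mul_apply, h3, facePerm_apply,
        SimpleGraph.Dart.symm_symm, pow_succ' _ (j + 1), Equiv.Perm.mul_apply]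
  refine ⟨_, hi, by rw [next_pow_fst]; rfl, walk i le_rfl, ?_⟩
  intro hback z hz hzd
  obtain ⟨n, rfl⟩ := reach z hzd
  -- If the face turns back, the rotation returns to `d.symm` after `i + 1` steps. By minimality of
  -- `i` no inner dart occurs in between, so `d.symm` is the only one at this vertex.
  have hper : ∀ m, (R.next ^ ((i + 1) * m)) d.symm = d.symm := by
    intro m
    induction m with
    | zero => simp
    | succ m ih => rw [Nat.mul_succ, pow_add, Equiv.Perm.mul_apply, hback, ih]
  have hmod : (R.next ^ (n + 1)) d.symm = (R.next ^ ((n + 1) % (i + 1))) d.symm := by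
    conv_lhs => rw [← Nat.mod_add_div (n + 1) (i + 1), pow_add, Equiv.Perm.mul_apply, hper]
  rw [hmod] at hz ⊢
  have hlt : (n + 1) % (i + 1) < i + 1 := Nat.mod_lt _ (by omega)
  obtain h | ⟨j, h⟩ : (n + 1) % (i + 1) = 0 ∨ ∃ j, (n + 1) % (i + 1) = j + 1 := by
    cases (n + 1) % (i + 1) <;> simp
  · rw [h]; rfl
  · rw [h] at hz hlt
    exact absurd hz (hmin j (by omega))

/-- Every face contains an inner dart. -/
theorem exists_isInner_sameCycle [Finite V] (hC : ∀ v ∈ C, ∃ y : G.Dart, IsInner C y ∧ y.fst = v)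
    (hadj : ∀ d : G.Dart, d.fst ∈ C ∨ d.snd ∈ C) (d : G.Dart) :
    ∃ d', IsInner C d' ∧ R.facePerm.SameCycle d d' := by
  by_cases h : d.snd ∈ C
  · obtain ⟨y, hy, hyd⟩ := hC _ h
    obtain ⟨d', h1, -, h2, -⟩ := exists_sameCycle_facePerm (R := R) leaf d y hy hyd
    exact ⟨d', h1, h2⟩
  · have h' : d.fst ∈ C := (hadj d).resolve_right h
    obtain ⟨y, hy, hyd⟩ := hC _ h'
    obtain ⟨d', h1, -, h2, -⟩ := exists_sameCycle_facePerm (R := R) leaf d.symm y hy hyd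
    refine ⟨d', h1, .trans ⟨1, ?_⟩ h2⟩
    rw [zpow_one, facePerm_of_snd_notMem leaf h]

/-- In a bipartite graph without isolated inner edges, every face has at least four inner darts. -/
theorem exists_four_sameCycle [Finite V] (col : V → Prop)
    (hcol : ∀ d : G.Dart, IsInner C d → (col d.fst ↔ ¬ col d.snd))
    (hdeg : ∀ d : G.Dart, IsInner C d →
      (∃ z, IsInner C z ∧ z.fst = d.fst ∧ z ≠ d) ∨ ∃ z, IsInner C z ∧ z.fst = d.snd ∧ z ≠ d.symm)
    (d₁ : G.Dart) (h₁ : IsInner C d₁) :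
    ∃ s : Finset G.Dart, s.card = 4 ∧ ∀ d ∈ s, IsInner C d ∧ R.facePerm.SameCycle d₁ d := by
  classical
  obtain ⟨d₂, h₂, e₂, c₂, b₂⟩ := exists_sameCycle_facePerm (R := R) leaf d₁ _ h₁.symm rfl
  obtain ⟨d₃, h₃, e₃, c₃, b₃⟩ := exists_sameCycle_facePerm (R := R) leaf d₂ _ h₂.symm rfl
  obtain ⟨d₄, h₄, e₄, c₄, b₄⟩ := exists_sameCycle_facePerm (R := R) leaf d₃ _ h₃.symm rfl
  have k₁ := hcol _ h₁
  have k₂ := hcol _ h₂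
  have k₃ := hcol _ h₃
  rw [e₂] at k₂
  rw [e₃] at k₃
  have n12 : d₁ ≠ d₂ := by rintro rfl; rw [e₂] at k₁; tauto
  have n23 : d₂ ≠ d₃ := by rintro rfl; rw [← e₃, e₂] at k₂; tauto
  have n34 : d₃ ≠ d₄ := by rintro rfl; rw [← e₄, e₃] at k₃; tauto
  have n14 : d₁ ≠ d₄ := by rintro rfl; rw [e₄] at k₁; tauto
  have turn : ∀ a b c : G.Dart, b.fst = a.snd → a = c → c.fst = b.snd → b = a.symm := by
    rintro a b c hb rfl hc
    ext
    · exact hb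
    · exact hc.symm
  -- Equality would mean that the face turns back at both ends of the edge of `d₁`, making that edge
  -- a component of the core, against `hdeg`. The other inequalities, except `n24`, come from the
  -- bipartition.
  have n13 : d₁ ≠ d₃ := by
    intro h
    have t₂ := turn d₁ d₂ d₃ e₂ h e₃
    have t₃ : d₃ = d₂.symm := by rw [← h, t₂, SimpleGraph.Dart.symm_symm]
    rcases hdeg d₁ h₁ with ⟨z, hz, hz1, hz2⟩ | ⟨z, hz, hz1, hz2⟩
    · exact hz2 (by rw [b₃ t₃ z hz (by rw [hz1, h, e₃]), ← t₃, h])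
    · exact hz2 (b₂ t₂ z hz hz1)
  have n24 : d₂ ≠ d₄ := by
    intro h
    have t₃ := turn d₂ d₃ d₄ e₃ h e₄
    have t₄ : d₄ = d₃.symm := by rw [← h, t₃, SimpleGraph.Dart.symm_symm]
    rcases hdeg d₂ h₂ with ⟨z, hz, hz1, hz2⟩ | ⟨z, hz, hz1, hz2⟩
    · exact hz2 (by rw [b₄ t₄ z hz (by rw [hz1, h, e₄]), ← t₄, h])
    · exact hz2 (b₃ t₃ z hz hz1)
  refine ⟨{d₁, d₂, d₃, d₄}, ?_, ?_⟩
  · simp [n12, n13, n14, n23, n24, n34]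
  · simp only [Finset.mem_insert, Finset.mem_singleton]
    rintro d (rfl | rfl | rfl | rfl)
    · exact ⟨h₁, .refl _ _⟩
    · exact ⟨h₂, c₂⟩
    · exact ⟨h₃, c₂.trans c₃⟩
    · exact ⟨h₄, (c₂.trans c₃).trans c₄⟩

/-- In a bipartite graph of minimum inner degree two, every face has at least six inner darts,
or contains all the darts of a directed four-cycle. -/
theorem exists_six_sameCycle [Finite V] (col : V → Prop)
    (hcol : ∀ d : G.Dart, IsInner C d → (col d.fst ↔ ¬ col d.snd))
    (hdeg : ∀ d : G.Dart, IsInner C d → ∃ z, IsInner C z ∧ z.fst = d.fst ∧ z ≠ d)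
    (d₁ : G.Dart) (h₁ : IsInner C d₁) :
    ∃ s : Finset G.Dart, (∀ d ∈ s, IsInner C d ∧ R.facePerm.SameCycle d₁ d) ∧
      (s.card = 6 ∨ s.card = 4 ∧ ∀ d ∈ s, ∃ x y, x ≠ d.fst ∧ y ≠ d.snd ∧ x ∈ C ∧ y ∈ C ∧
        G.Adj x d.snd ∧ G.Adj x y ∧ G.Adj d.fst y) := by
  classical
  -- With inner degree at least two the face never turns back inside the core, so tails of darts two
  -- steps apart are distinct.
  have step : ∀ d : G.Dart, IsInner C d → ∃ d', IsInner C d' ∧ d'.fst = d.snd ∧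
      R.facePerm.SameCycle d d' ∧ d'.snd ≠ d.fst := by
    intro d hd
    obtain ⟨d', h, e, c, b⟩ := exists_sameCycle_facePerm (R := R) leaf d _ hd.symm rfl
    refine ⟨d', h, e, c, fun hd' => ?_⟩
    obtain ⟨z, hz, hz1, hz2⟩ := hdeg d.symm hd.symm
    exact hz2 (b (SimpleGraph.Dart.ext _ _ (Prod.ext e hd')) z hz hz1)
  obtain ⟨d₂, h₂, e₂, c₂, b₂⟩ := step d₁ h₁
  obtain ⟨d₃, h₃, e₃, c₃, b₃⟩ := step d₂ h₂
  obtain ⟨d₄, h₄, e₄, c₄, b₄⟩ := step d₃ h₃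
  obtain ⟨d₅, h₅, e₅, c₅, b₅⟩ := step d₄ h₄
  obtain ⟨d₆, h₆, e₆, c₆, b₆⟩ := step d₅ h₅
  have k₁ := hcol _ h₁
  have k₂ := hcol _ h₂
  have k₃ := hcol _ h₃
  have k₄ := hcol _ h₄
  have k₅ := hcol _ h₅
  have a₁ := d₁.adj
  have a₂ := d₂.adj
  have a₃ := d₃.adj
  have a₄ := d₄.adj
  have a₅ := d₅.adj
  have a₁ := d₁.adj
  have a₂ := d₂.adj
  have a₃ := d₃.adj
  have a₄ := d₄.adj
  have a₅ := d₅.adj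
  have ne : ∀ a b : G.Dart, a.fst ≠ b.fst → a ≠ b := fun a b h h' => h (by rw [h'])
  have nc : ∀ a b : G.Dart, (col a.fst ↔ ¬ col b.fst) → a ≠ b := by
    rintro a b h rfl
    exact iff_not_self h
  have odd : ∀ {p q r s : Prop}, (p ↔ ¬ q) → (q ↔ ¬ r) → (r ↔ ¬ s) → (p ↔ ¬ s) := by
    intro p q r s h h' h''
    rw [h, h', h'', not_not]
  change G.Adj d₁.fst d₁.snd at a₁
  change G.Adj d₂.fst d₂.snd at a₂
  change G.Adj d₃.fst d₃.snd at a₃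
  change G.Adj d₄.fst d₄.snd at a₄
  change G.Adj d₅.fst d₅.snd at a₅
  rw [← e₂] at k₁ a₁
  rw [← e₃] at k₂ a₂ b₂
  rw [← e₄] at k₃ a₃ b₃
  rw [← e₅] at k₄ a₄ b₄
  rw [← e₆] at k₅ a₅ b₅
  have c₃' := c₂.trans c₃
  have c₄' := c₃'.trans c₄
  have c₅' := c₄'.trans c₅
  have c₆' := c₅'.trans c₆
  have n12 : d₁ ≠ d₂ := nc _ _ k₁
  have n13 : d₁ ≠ d₃ := ne _ _ b₂.symm
  have n14 : d₁ ≠ d₄ := nc _ _ (odd k₁ k₂ k₃)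
  have n23 : d₂ ≠ d₃ := nc _ _ k₂
  have n24 : d₂ ≠ d₄ := ne _ _ b₃.symm
  have n25 : d₂ ≠ d₅ := nc _ _ (odd k₂ k₃ k₄)
  have n34 : d₃ ≠ d₄ := nc _ _ k₃
  have n35 : d₃ ≠ d₅ := ne _ _ b₄.symm
  have n45 : d₄ ≠ d₅ := nc _ _ k₄
  -- Among six successive inner darts, those at odd distance differ by colour and those at distance
  -- two by the lack of turning back. Only distance four is left, and a coincidence of tails there
  -- closes a genuine four-cycle.
  by_cases h15 : d₁.fst = d₅.fst
  · refine ⟨{d₁, d₂, d₃, d₄}, ?_, .inr ⟨by simp [n12, n13, n14, n23, n24, n34], ?_⟩⟩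
    · simp only [Finset.mem_insert, Finset.mem_singleton]
      rintro d (rfl | rfl | rfl | rfl)
      exacts [⟨h₁, .refl _ _⟩, ⟨h₂, c₂⟩, ⟨h₃, c₃'⟩, ⟨h₄, c₄'⟩]
    · rw [← h15] at a₄ e₅
      simp only [Finset.mem_insert, Finset.mem_singleton]
      rintro d (rfl | rfl | rfl | rfl)
      · exact ⟨d₃.fst, d₄.fst, b₂, e₂ ▸ b₃, h₃.1, h₄.1, e₂ ▸ a₂.symm, a₃, a₄.symm⟩
      · exact ⟨d₄.fst, d₁.fst, b₃, e₃ ▸ b₂.symm, h₄.1, h₁.1, e₃ ▸ a₃.symm, a₄, a₁.symm⟩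
      · exact ⟨d₁.fst, d₂.fst, b₂.symm, e₄ ▸ b₃.symm, h₁.1, h₂.1, e₄ ▸ a₄.symm, a₁, a₂.symm⟩
      · exact ⟨d₂.fst, d₃.fst, b₃.symm, e₅ ▸ b₂, h₂.1, h₃.1, e₅ ▸ a₁.symm, a₂, a₃.symm⟩
  by_cases h26 : d₂.fst = d₆.fst
  · refine ⟨{d₂, d₃, d₄, d₅}, ?_, .inr ⟨by simp [n23, n24, n25, n34, n35, n45], ?_⟩⟩
    · simp only [Finset.mem_insert, Finset.mem_singleton]
      rintro d (rfl | rfl | rfl | rfl)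
      exacts [⟨h₂, c₂⟩, ⟨h₃, c₃'⟩, ⟨h₄, c₄'⟩, ⟨h₅, c₅'⟩]
    · rw [← h26] at a₅ e₆
      simp only [Finset.mem_insert, Finset.mem_singleton]
      rintro d (rfl | rfl | rfl | rfl)
      · exact ⟨d₄.fst, d₅.fst, b₃, e₃ ▸ b₄, h₄.1, h₅.1, e₃ ▸ a₃.symm, a₄, a₅.symm⟩
      · exact ⟨d₅.fst, d₂.fst, b₄, e₄ ▸ b₃.symm, h₅.1, h₂.1, e₄ ▸ a₄.symm, a₅, a₂.symm⟩
      · exact ⟨d₂.fst, d₃.fst, b₃.symm, e₅ ▸ b₄.symm, h₂.1, h₃.1, e₅ ▸ a₅.symm, a₂, a₃.symm⟩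
      · exact ⟨d₃.fst, d₄.fst, b₄.symm, e₆ ▸ b₃, h₃.1, h₄.1, e₆ ▸ a₂.symm, a₃, a₄.symm⟩
  have n15 : d₁ ≠ d₅ := ne _ _ h15
  have n16 : d₁ ≠ d₆ := nc _ _ (odd (odd k₁ k₂ k₃) k₄ k₅)
  have n26 : d₂ ≠ d₆ := ne _ _ h26
  have n36 : d₃ ≠ d₆ := nc _ _ (odd k₃ k₄ k₅)
  have n46 : d₄ ≠ d₆ := ne _ _ b₅.symm
  have n56 : d₅ ≠ d₆ := nc _ _ k₅
  refine ⟨{d₁, d₂, d₃, d₄, d₅, d₆}, ?_, .inl ?_⟩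
  · simp only [Finset.mem_insert, Finset.mem_singleton]
    rintro d (rfl | rfl | rfl | rfl | rfl | rfl)
    exacts [⟨h₁, .refl _ _⟩, ⟨h₂, c₂⟩, ⟨h₃, c₃'⟩, ⟨h₄, c₄'⟩, ⟨h₅, c₅'⟩, ⟨h₆, c₆'⟩]
  · simp [n12, n13, n14, n15, n16, n23, n24, n25, n26, n34, n35, n36, n45, n46, n56]

omit leaf in
/-- If the inner darts of every face have total weight at least `k`, then there are at most
`1 / k` times as many faces as the total weight of all inner darts. -/
theorem mul_numFaces_le [Finite V] (w : G.Dart → ℕ) (k : ℕ) (T : Finset G.Dart)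
    (h : ∀ d : G.Dart, ∃ s ⊆ T, (∀ d' ∈ s, R.facePerm.SameCycle d d') ∧ k ≤ ∑ d' ∈ s, w d') :
    k * R.numFaces ≤ ∑ d ∈ T, w d := by
  classical
  have : Finite G.Dart := Finite.of_injective _ SimpleGraph.Dart.toProd_injective
  let Q := Quotient (Equiv.Perm.SameCycle.setoid R.facePerm)
  have : Finite Q := Quotient.finite _
  have : Fintype Q := Fintype.ofFinite Q
  let f : G.Dart → Q := fun d => Quotient.mk _ d
  have hQ : R.numFaces = Fintype.card Q := Nat.card_eq_fintype_card
  rw [hQ, ← Finset.sum_fiberwise (s := T) (g := f), mul_comm, ← smul_eq_mul,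
    ← Finset.card_univ, ← Finset.sum_const]
  refine Finset.sum_le_sum fun c _ => ?_
  obtain ⟨d, rfl⟩ := Quotient.exists_rep c
  obtain ⟨s, hsT, hs, hk⟩ := h d
  refine hk.trans (Finset.sum_le_sum_of_subset fun d' hd' => ?_)
  rw [Finset.mem_filter]
  exact ⟨hsT hd', Quotient.sound (hs d' hd').symm⟩

end RotationSystem

/-! ### The line network of a projective plane. -/

/-- A projective plane of order `q` in which the points `pt l 0, …, pt l q` of every line `l` and
the lines `ln p 0, …, ln p q` through every point `p` are enumerated. -/
structure OrderedPlane (q : ℕ) (P L : Type) where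
  pt : L → ℕ → P
  ln : P → ℕ → L
  pt_inj : ∀ l i j, i ≤ q → j ≤ q → pt l i = pt l j → i = j
  ln_inj : ∀ p i j, i ≤ q → j ≤ q → ln p i = ln p j → i = j
  incident : ∀ p l, (∃ i ≤ q, pt l i = p) ↔ ∃ j ≤ q, ln p j = l
  exists_line : ∀ p p', p ≠ p' → ∃ l, (∃ i ≤ q, pt l i = p) ∧ ∃ i ≤ q, pt l i = p'
  exists_point : ∀ l l', l ≠ l' → ∃ p, (∃ i ≤ q, pt l i = p) ∧ ∃ i ≤ q, pt l' i = p
  eq_or_eq : ∀ p p' l l', (∃ i ≤ q, pt l i = p) → (∃ i ≤ q, pt l i = p') →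
    (∃ i ≤ q, pt l' i = p) → (∃ i ≤ q, pt l' i = p') → p = p' ∨ l = l'

namespace OrderedPlane

/-- The vertices of the network of a projective plane: two for every point, and the two terminals
of every line. -/
inductive Vert (P L : Type)
  | inn (p : P)
  | out (p : P)
  | src (l : L)
  | tgt (l : L)

open Vert

/-- Vertices as elements of a sum type. -/
def vertEquiv (P L : Type) : Vert P L ≃ (P ⊕ P) ⊕ (L ⊕ L) where
  toFun
    | inn p => .inl (.inl p)
    | out p => .inl (.inr p)
    | src l => .inr (.inl l)
    | tgt l => .inr (.inr l)
  invFun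
    | .inl (.inl p) => inn p
    | .inl (.inr p) => out p
    | .inr (.inl l) => src l
    | .inr (.inr l) => tgt l
  left_inv v := by cases v <;> rfl
  right_inv v := by rcases v with (p | p) | (l | l) <;> rfl

noncomputable instance {P L : Type} [Fintype P] [Fintype L] : Fintype (Vert P L) :=
  Fintype.ofEquiv _ (vertEquiv P L).symm

theorem card_vert {P L : Type} [Fintype P] [Fintype L] :
    Nat.card (Vert P L) = 2 * Fintype.card P + 2 * Fintype.card L := by
  rw [Nat.card_congr (vertEquiv P L), Nat.card_eq_fintype_card]
  simp only [Fintype.card_sum]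
  ring

variable {q : ℕ} {P L : Type} (X : OrderedPlane q P L)

/-- The point `p` lies on the line `l`. -/
def On (p : P) (l : L) : Prop := ∃ i ≤ q, X.pt l i = p

variable {X} in
theorem On.line_unique {p p' : P} {l l' : L} (h : p ≠ p') (h1 : X.On p l) (h2 : X.On p' l)
    (h3 : X.On p l') (h4 : X.On p' l') : l = l' :=
  (X.eq_or_eq p p' l l' h1 h2 h3 h4).resolve_left h

variable {X} in
theorem On.point_unique {p p' : P} {l l' : L} (h : l ≠ l') (h1 : X.On p l) (h2 : X.On p l')
    (h3 : X.On p' l) (h4 : X.On p' l') : p = p' :=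
  (X.eq_or_eq p p' l l' h1 h3 h2 h4).resolve_right h

theorem on_pt (l : L) {i : ℕ} (hi : i ≤ q) : X.On (X.pt l i) l := ⟨i, hi, rfl⟩

theorem on_ln (p : P) {j : ℕ} (hj : j ≤ q) : X.On p (X.ln p j) :=
  (X.incident _ _).2 ⟨j, hj, rfl⟩

/-- On some line, `x` is the successor of `p`. -/
def Step (p x : P) : Prop := ∃ l, ∃ i < q, X.pt l i = p ∧ X.pt l (i + 1) = x

theorem step_irrefl (p : P) : ¬ X.Step p p := by
  rintro ⟨l, i, hi, h1, h2⟩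
  have := X.pt_inj l i (i + 1) (by omega) (by omega) (h1.trans h2.symm)
  omega

/-- The edges of the network, oriented along the lines. -/
def Arc : Vert P L → Vert P L → Prop
  | inn p, out x => p = x
  | out p, inn x => X.Step p x
  | src l, inn x => x = X.pt l 0
  | out p, tgt l => p = X.pt l q
  | _, _ => False

/-- The graph of a projective plane. -/
def graph : SimpleGraph (Vert P L) where
  Adj u v := X.Arc u v ∨ X.Arc v u
  symm := ⟨fun _ _ h => h.symm⟩
  loopless := ⟨fun v => by cases v <;> simp [Arc]⟩

theorem graph_adj (u v : Vert P L) : X.graph.Adj u v ↔ X.Arc u v ∨ X.Arc v u := Iff.rfl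

theorem twin_adj (p : P) : X.graph.Adj (inn p) (out p) := .inl rfl

theorem start_adj (l : L) : X.graph.Adj (src l) (inn (X.pt l 0)) := .inl rfl

theorem stop_adj (l : L) : X.graph.Adj (out (X.pt l q)) (tgt l) := .inl rfl

theorem step_adj (l : L) {i : ℕ} (hi : i < q) :
    X.graph.Adj (out (X.pt l i)) (inn (X.pt l (i + 1))) := .inl ⟨l, i, hi, rfl, rfl⟩

/-- The initial part of the line `l` up to its `k`-th point. -/
def prefixWalk (l : L) : ∀ k, k ≤ q → X.graph.Walk (src l) (out (X.pt l k))
  | 0, _ => .cons (X.start_adj l) (.cons (X.twin_adj _) .nil)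
  | k + 1, h => ((prefixWalk l k (by omega)).concat (X.step_adj l h)).concat (X.twin_adj _)

theorem mem_support_prefixWalk (l : L) (k : ℕ) (hk : k ≤ q) (v : Vert P L) :
    v ∈ (X.prefixWalk l k hk).support ↔
      v = src l ∨ ∃ i ≤ k, v = inn (X.pt l i) ∨ v = out (X.pt l i) := by
  induction k with
  | zero => simp [prefixWalk]
  | succ k ih =>
    simp only [prefixWalk, SimpleGraph.Walk.support_concat,
      List.mem_append, ih, List.mem_singleton, Nat.le_succ_iff_eq_or_le, Nat.succ_eq_add_one, or_and_right,
      exists_or, exists_eq_left]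
    simp only [or_assoc, or_left_comm, or_comm]

theorem mem_edges_prefixWalk (l : L) (k : ℕ) (hk : k ≤ q) (e : Sym2 (Vert P L)) :
    e ∈ (X.prefixWalk l k hk).edges ↔ e = s(src l, inn (X.pt l 0)) ∨
      (∃ i ≤ k, e = s(inn (X.pt l i), out (X.pt l i))) ∨
      ∃ i < k, e = s(out (X.pt l i), inn (X.pt l (i + 1))) := by
  induction k with
  | zero => simp [prefixWalk]
  | succ k ih =>
    simp only [prefixWalk, SimpleGraph.Walk.edges_concat, List.concat_eq_append,
      List.mem_append, ih, List.mem_singleton, Nat.le_succ_iff_eq_or_le, Nat.succ_eq_add_one, or_and_right,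
      exists_or, exists_eq_left, Nat.lt_succ_iff_lt_or_eq]
    simp only [or_assoc, or_left_comm, or_comm]

theorem isPath_prefixWalk (l : L) (k : ℕ) (hk : k ≤ q) : (X.prefixWalk l k hk).IsPath := by
  induction k with
  | zero => simp [prefixWalk]
  | succ k ih =>
    have hne : ∀ i ≤ k, X.pt l (k + 1) ≠ X.pt l i := by
      intro i hi h
      have := X.pt_inj l _ _ hk (by omega) h
      omega
    refine ((ih (by omega)).concat ?_ _).concat ?_ _
    · rw [mem_support_prefixWalk]
      simpa using hne
    · rw [SimpleGraph.Walk.support_concat, List.mem_append,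
        mem_support_prefixWalk]
      simpa using hne

/-- The path of the line `l`. -/
def lineWalk (l : L) : X.graph.Walk (src l) (tgt l) :=
  (X.prefixWalk l q le_rfl).concat (X.stop_adj l)

/-- The neighbour of `inn (pt l i)` on the line `l` that precedes it. -/
def prevAt (l : L) : ℕ → Vert P L
  | 0 => src l
  | i + 1 => out (X.pt l i)

/-- The neighbour of `out (pt l i)` on the line `l` that succeeds it. -/
def nextAt (l : L) (i : ℕ) : Vert P L := if i = q then tgt l else inn (X.pt l (i + 1))

theorem prevAt_adj (l : L) {i : ℕ} (hi : i ≤ q) :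
    X.graph.Adj (X.prevAt l i) (inn (X.pt l i)) := by
  cases i with
  | zero => exact .inl rfl
  | succ i => exact .inl ⟨l, i, by omega, rfl, rfl⟩

theorem nextAt_adj (l : L) {i : ℕ} (hi : i ≤ q) :
    X.graph.Adj (out (X.pt l i)) (X.nextAt l i) := by
  unfold nextAt
  split_ifs with h
  · subst h; exact .inl rfl
  · exact .inl ⟨l, i, by omega, rfl, rfl⟩

open Classical in
/-- The position of the point `p` on the line `l`. -/
noncomputable def pos (p : P) (l : L) : ℕ := if h : X.On p l then h.choose else 0

theorem pos_le (p : P) (l : L) : X.pos p l ≤ q := by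
  unfold pos
  split_ifs with h
  · exact h.choose_spec.1
  · omega

theorem pt_pos {p : P} {l : L} (h : X.On p l) : X.pt l (X.pos p l) = p := by
  unfold pos
  rw [dif_pos h]
  exact h.choose_spec.2

theorem pos_pt (l : L) {i : ℕ} (hi : i ≤ q) : X.pos (X.pt l i) l = i :=
  X.pt_inj l _ _ (X.pos_le _ _) hi (X.pt_pos (X.on_pt l hi))

theorem prevAt_inj {p : P} {l l' : L} (h : X.On p l) (h' : X.On p l')
    (e : X.prevAt l (X.pos p l) = X.prevAt l' (X.pos p l')) : l = l' := by
  have h1 := X.pt_pos h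
  have h1' := X.pt_pos h'
  have h2 := X.pos_le p l
  have h2' := X.pos_le p l'
  generalize X.pos p l = i at *
  generalize X.pos p l' = j at *
  cases i with
  | zero => cases j <;> simp_all [prevAt]
  | succ i =>
    cases j with
    | zero => simp [prevAt] at e
    | succ j =>
      simp only [prevAt, out.injEq] at e
      refine On.line_unique (X := X) (p := p) (p' := X.pt l i) ?_ h (X.on_pt l (by omega)) h'
        ⟨j, by omega, e.symm⟩
      intro h3
      have := X.pt_inj l (i + 1) i h2 (by omega) (h1.trans h3)
      omega

theorem nextAt_inj {p : P} {l l' : L} (h : X.On p l) (h' : X.On p l')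
    (e : X.nextAt l (X.pos p l) = X.nextAt l' (X.pos p l')) : l = l' := by
  have h1 := X.pt_pos h
  have h1' := X.pt_pos h'
  have h2 := X.pos_le p l
  have h2' := X.pos_le p l'
  generalize X.pos p l = i at *
  generalize X.pos p l' = j at *
  unfold nextAt at e
  split_ifs at e with hi hj hj
  · exact tgt.inj e
  · have e := inn.inj e
    refine On.line_unique (X := X) (p := p) (p' := X.pt l (i + 1)) ?_ h (X.on_pt l (by omega)) h'
      ⟨j + 1, by omega, e.symm⟩
    intro h3
    have := X.pt_inj l (i + 1) i (by omega) h2 (h3.symm.trans h1.symm)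
    omega

/-- The number of neighbours of a vertex, minus one. -/
def deg (q : ℕ) {P L : Type} : Vert P L → ℕ
  | inn _ => q + 1
  | out _ => q + 1
  | src _ => 0
  | tgt _ => 0

/-- The neighbours of a vertex in clockwise order: at both vertices of a point, its lines come
in the same order. -/
noncomputable def nb : Vert P L → ℕ → Vert P L
  | inn p, 0 => out p
  | inn p, j + 1 => X.prevAt (X.ln p j) (X.pos p (X.ln p j))
  | out p, 0 => inn p
  | out p, j + 1 => X.nextAt (X.ln p j) (X.pos p (X.ln p j))
  | src l, _ => inn (X.pt l 0)
  | tgt l, _ => out (X.pt l q)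

theorem nb_adj (v : Vert P L) (i : ℕ) (hi : i ≤ deg q v) : X.graph.Adj v (X.nb v i) := by
  cases v with
  | inn p =>
    cases i with
    | zero => exact .inl rfl
    | succ j =>
      have h := X.prevAt_adj (X.ln p j) (X.pos_le p (X.ln p j))
      rw [X.pt_pos (X.on_ln p (Nat.succ_le_succ_iff.1 hi))] at h
      exact h.symm
  | out p =>
    cases i with
    | zero => exact .inr rfl
    | succ j =>
      have h := X.nextAt_adj (X.ln p j) (X.pos_le p (X.ln p j))
      rwa [X.pt_pos (X.on_ln p (Nat.succ_le_succ_iff.1 hi))] at h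
  | src l => exact .inl rfl
  | tgt l => exact .inr rfl

theorem prevAt_ne_out {p : P} {l : L} (h : X.On p l) : X.prevAt l (X.pos p l) ≠ out p := by
  have h1 := X.pt_pos h
  have h2 := X.pos_le p l
  generalize X.pos p l = i at *
  cases i with
  | zero => simp [prevAt]
  | succ i =>
    intro e
    have := X.pt_inj l (i + 1) i h2 (by omega) (h1.trans (out.inj e).symm)
    omega

theorem nextAt_ne_inn {p : P} {l : L} (h : X.On p l) : X.nextAt l (X.pos p l) ≠ inn p := by
  have h1 := X.pt_pos h
  have h2 := X.pos_le p l
  generalize X.pos p l = i at *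
  unfold nextAt
  split_ifs with hi
  · simp
  · intro e
    have := X.pt_inj l i (i + 1) h2 (by omega) (h1.trans (inn.inj e).symm)
    omega

theorem nb_inj (v : Vert P L) (i j : ℕ) (hi : i ≤ deg q v) (hj : j ≤ deg q v)
    (h : X.nb v i = X.nb v j) : i = j := by
  cases v with
  | inn p =>
    rcases i with _ | i <;> rcases j with _ | j
    · rfl
    · exact absurd h.symm (X.prevAt_ne_out (X.on_ln p (Nat.succ_le_succ_iff.1 hj)))
    · exact absurd h (X.prevAt_ne_out (X.on_ln p (Nat.succ_le_succ_iff.1 hi)))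
    · have hi := Nat.succ_le_succ_iff.1 hi
      have hj := Nat.succ_le_succ_iff.1 hj
      rw [X.ln_inj p i j hi hj (X.prevAt_inj (X.on_ln p hi) (X.on_ln p hj) h)]
  | out p =>
    rcases i with _ | i <;> rcases j with _ | j
    · rfl
    · exact absurd h.symm (X.nextAt_ne_inn (X.on_ln p (Nat.succ_le_succ_iff.1 hj)))
    · exact absurd h (X.nextAt_ne_inn (X.on_ln p (Nat.succ_le_succ_iff.1 hi)))
    · have hi := Nat.succ_le_succ_iff.1 hi
      have hj := Nat.succ_le_succ_iff.1 hj
      rw [X.ln_inj p i j hi hj (X.nextAt_inj (X.on_ln p hi) (X.on_ln p hj) h)]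
  | src l => simp only [deg] at hi hj; omega
  | tgt l => simp only [deg] at hi hj; omega

/-- The neighbours of `inn p`. -/
theorem inn_adj (p : P) (v : Vert P L) : X.graph.Adj (inn p) v ↔
    v = out p ∨ ∃ l, X.On p l ∧ v = X.prevAt l (X.pos p l) := by
  constructor
  · cases v with
    | inn x => simp [graph_adj, Arc]
    | out x =>
      rintro (h | ⟨l, i, hi, rfl, rfl⟩)
      · exact .inl (by rw [show p = x from h])
      · exact .inr ⟨l, X.on_pt l hi, by rw [X.pos_pt l hi]; rfl⟩
    | src l =>
      rintro (h | h)
      · exact h.elim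
      · obtain rfl : p = X.pt l 0 := h
        exact .inr ⟨l, X.on_pt l (by omega), by rw [X.pos_pt l (by omega)]; rfl⟩
    | tgt l => simp [graph_adj, Arc]
  · rintro (rfl | ⟨l, h, rfl⟩)
    · exact .inl rfl
    · have := X.prevAt_adj l (X.pos_le p l)
      rw [X.pt_pos h] at this
      exact this.symm

/-- The neighbours of `out p`. -/
theorem out_adj (p : P) (v : Vert P L) : X.graph.Adj (out p) v ↔
    v = inn p ∨ ∃ l, X.On p l ∧ v = X.nextAt l (X.pos p l) := by
  constructor
  · cases v with
    | inn x =>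
      rintro (⟨l, i, hi, rfl, rfl⟩ | h)
      · exact .inr ⟨l, X.on_pt l hi.le, by rw [X.pos_pt l hi.le, nextAt, if_neg hi.ne]⟩
      · exact .inl (by rw [show x = p from h])
    | out x => simp [graph_adj, Arc]
    | src l => simp [graph_adj, Arc]
    | tgt l =>
      rintro (h | h)
      · obtain rfl : p = X.pt l q := h
        exact .inr ⟨l, X.on_pt l le_rfl, by rw [X.pos_pt l le_rfl, nextAt, if_pos rfl]⟩
      · exact h.elim
  · rintro (rfl | ⟨l, h, rfl⟩)
    · exact .inr rfl
    · have := X.nextAt_adj l (X.pos_le p l)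
      rwa [X.pt_pos h] at this

theorem src_adj (l : L) (v : Vert P L) : X.graph.Adj (src l) v ↔ v = inn (X.pt l 0) := by
  cases v <;> simp [graph_adj, Arc]

theorem tgt_adj (l : L) (v : Vert P L) : X.graph.Adj (tgt l) v ↔ v = out (X.pt l q) := by
  cases v <;> simp [graph_adj, Arc]

theorem nb_surj (v w : Vert P L) (h : X.graph.Adj v w) : ∃ i ≤ deg q v, X.nb v i = w := by
  cases v with
  | inn p =>
    obtain rfl | ⟨l, hl, rfl⟩ := (X.inn_adj p w).1 h
    · exact ⟨0, by omega, rfl⟩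
    · obtain ⟨j, hj, rfl⟩ := (X.incident _ _).1 hl
      exact ⟨j + 1, Nat.succ_le_succ hj, rfl⟩
  | out p =>
    obtain rfl | ⟨l, hl, rfl⟩ := (X.out_adj p w).1 h
    · exact ⟨0, by omega, rfl⟩
    · obtain ⟨j, hj, rfl⟩ := (X.incident _ _).1 hl
      exact ⟨j + 1, Nat.succ_le_succ hj, rfl⟩
  | src l => exact ⟨0, by omega, ((X.src_adj l w).1 h).symm⟩
  | tgt l => exact ⟨0, by omega, ((X.tgt_adj l w).1 h).symm⟩

/-- The line network of a projective plane. -/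
noncomputable def network : LineNetwork (Vert P L) L where
  graph := X.graph
  rot := .ofNeighbors (deg q) X.nb X.nb_adj X.nb_inj X.nb_surj
  src := src
  tgt := tgt
  line := X.lineWalk
  isPath l := (X.isPath_prefixWalk l q le_rfl).concat
    (by rw [mem_support_prefixWalk]; simp) _

theorem mem_support_line (l : L) (v : Vert P L) : v ∈ (X.network.line l).support ↔
    v = src l ∨ v = tgt l ∨ ∃ p, X.On p l ∧ (v = inn p ∨ v = out p) := by
  change v ∈ (X.lineWalk l).support ↔ _
  rw [lineWalk, SimpleGraph.Walk.support_concat, List.mem_append,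
    mem_support_prefixWalk, List.mem_singleton]
  constructor
  · rintro ((h | ⟨i, hi, h⟩) | h)
    · exact .inl h
    · exact .inr (.inr ⟨_, ⟨i, hi, rfl⟩, h⟩)
    · exact .inr (.inl h)
  · rintro (h | h | ⟨_, ⟨i, hi, rfl⟩, h⟩)
    · exact .inl (.inl h)
    · exact .inr h
    · exact .inl (.inr ⟨i, hi, h⟩)

theorem mem_linesOn (l : L) (e : Sym2 (Vert P L)) : l ∈ X.network.linesOn e ↔
    e = s(src l, inn (X.pt l 0)) ∨ (∃ p, X.On p l ∧ e = s(inn p, out p)) ∨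
      (∃ i < q, e = s(out (X.pt l i), inn (X.pt l (i + 1)))) ∨ e = s(out (X.pt l q), tgt l) := by
  change e ∈ (X.lineWalk l).edges ↔ _
  rw [lineWalk, SimpleGraph.Walk.edges_concat, List.concat_eq_append, List.mem_append,
    mem_edges_prefixWalk, List.mem_singleton]
  constructor
  · rintro ((h | ⟨i, hi, h⟩ | h) | h)
    · exact .inl h
    · exact .inr (.inl ⟨_, ⟨i, hi, rfl⟩, h⟩)
    · exact .inr (.inr (.inl h))
    · exact .inr (.inr (.inr h))
  · rintro (h | ⟨_, ⟨i, hi, rfl⟩, h⟩ | h | h)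
    · exact .inl (.inl h)
    · exact .inl (.inr (.inl ⟨i, hi, h⟩))
    · exact .inl (.inr (.inr h))
    · exact .inr h

/-- The edge joining the two vertices of a point. -/
def twin (P L : Type) (p : P) : Sym2 (Vert P L) := s(inn p, out p)

theorem twin_injective : Function.Injective (twin P L) := by
  intro p p' h
  simpa [twin] using h

theorem mem_linesOn_twin (p : P) (l : L) : l ∈ X.network.linesOn (twin P L p) ↔ X.On p l := by
  rw [mem_linesOn]
  constructor
  · rintro (h | ⟨x, hx, h⟩ | ⟨i, hi, h⟩ | h)
    · simp [twin] at h
    · obtain rfl := twin_injective (L := L) h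
      exact hx
    · simp only [twin, Sym2.eq_iff, reduceCtorEq, and_self, inn.injEq, out.injEq,
        false_or] at h
      have := X.pt_inj l i (i + 1) (by omega) (by omega) (h.2.symm.trans h.1)
      omega
    · simp [twin] at h
  · intro h
    exact .inr (.inl ⟨p, h, rfl⟩)

/-- A line using this edge contains two distinct points of `l`, hence is `l`. -/
theorem linesOn_step (l : L) {i : ℕ} (hi : i < q) :
    X.network.linesOn s(out (X.pt l i), inn (X.pt l (i + 1))) = {l} := by
  ext l'
  rw [Set.mem_singleton_iff, mem_linesOn]
  have hne : X.pt l i ≠ X.pt l (i + 1) := by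
    intro h
    have := X.pt_inj l i (i + 1) (by omega) (by omega) h
    omega
  constructor
  · rintro (h | ⟨x, hx, h⟩ | ⟨j, hj, h⟩ | h)
    · simp at h
    · simp only [Sym2.eq_iff, reduceCtorEq, and_self, inn.injEq, out.injEq, false_or] at h
      exact absurd (h.1.trans h.2.symm) hne
    · simp only [Sym2.eq_iff, reduceCtorEq, and_self, inn.injEq, out.injEq, or_false] at h
      exact (On.line_unique hne (X.on_pt l hi.le) (X.on_pt l hi)
        ⟨j, hj.le, h.1.symm⟩ ⟨j + 1, hj, h.2.symm⟩).symm
    · simp at h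
  · rintro rfl
    exact .inr (.inr (.inl ⟨i, hi, rfl⟩))

theorem linesOn_src (l : L) : X.network.linesOn s(src l, inn (X.pt l 0)) = {l} := by
  ext l'
  rw [Set.mem_singleton_iff, mem_linesOn]
  constructor
  · rintro (h | ⟨x, hx, h⟩ | ⟨j, hj, h⟩ | h) <;> simp at h
    exact h.1.symm
  · rintro rfl
    exact .inl rfl

theorem linesOn_tgt (l : L) : X.network.linesOn s(out (X.pt l q), tgt l) = {l} := by
  ext l'
  rw [Set.mem_singleton_iff, mem_linesOn]
  constructor
  · rintro (h | ⟨x, hx, h⟩ | ⟨j, hj, h⟩ | h) <;> simp at h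
    exact h.2.symm
  · rintro rfl
    exact .inr (.inr (.inr rfl))

theorem linesOn_prevAt (p : P) (l : L) (h : X.On p l) :
    X.network.linesOn s(inn p, X.prevAt l (X.pos p l)) = {l} := by
  obtain ⟨i, hi, rfl⟩ := h
  rw [X.pos_pt l hi, Sym2.eq_swap]
  cases i with
  | zero => exact X.linesOn_src l
  | succ i => exact X.linesOn_step l (by omega)

theorem linesOn_nextAt (p : P) (l : L) (h : X.On p l) :
    X.network.linesOn s(out p, X.nextAt l (X.pos p l)) = {l} := by
  obtain ⟨i, hi, rfl⟩ := h
  rw [X.pos_pt l hi, nextAt]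
  split_ifs with h
  · subst h
    exact X.linesOn_tgt l
  · exact X.linesOn_step l (by omega)

/-- Every edge either belongs to a point or carries exactly one line. -/
theorem twin_or_linesOn_singleton (e : Sym2 (Vert P L)) (he : e ∈ X.graph.edgeSet) :
    (∃ p, e = twin P L p) ∨ ∃ l, X.network.linesOn e = {l} := by
  induction e with
  | _ u v =>
    rw [SimpleGraph.mem_edgeSet] at he
    cases u with
    | inn p =>
      obtain rfl | ⟨l, hl, rfl⟩ := (X.inn_adj p v).1 he
      · exact .inl ⟨p, rfl⟩
      · exact .inr ⟨l, X.linesOn_prevAt p l hl⟩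
    | out p =>
      obtain rfl | ⟨l, hl, rfl⟩ := (X.out_adj p v).1 he
      · exact .inl ⟨p, Sym2.eq_swap⟩
      · exact .inr ⟨l, X.linesOn_nextAt p l hl⟩
    | src l =>
      obtain rfl := (X.src_adj l v).1 he
      exact .inr ⟨l, X.linesOn_src l⟩
    | tgt l =>
      obtain rfl := (X.tgt_adj l v).1 he
      exact .inr ⟨l, by rw [Sym2.eq_swap]; exact X.linesOn_tgt l⟩

theorem twin_mem_edgeSet (p : P) : twin P L p ∈ X.graph.edgeSet := .inl rfl

/-- The condition `1 ≤ q` provides two distinct lines through each point. -/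
theorem multiEdges_eq (hq : 1 ≤ q) : X.network.multiEdges = Set.range (twin P L) := by
  ext e
  constructor
  · rintro ⟨he, hn⟩
    obtain ⟨p, rfl⟩ | ⟨l, hl⟩ := X.twin_or_linesOn_singleton e he
    · exact ⟨p, rfl⟩
    · rw [hl] at hn
      exact absurd hn Set.not_nontrivial_singleton
  · rintro ⟨p, rfl⟩
    refine ⟨X.twin_mem_edgeSet p, X.ln p 0, (X.mem_linesOn_twin _ _).2 (X.on_ln p (by omega)),
      X.ln p 1, (X.mem_linesOn_twin _ _).2 (X.on_ln p hq), fun h => ?_⟩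
    have := X.ln_inj p 0 1 (by omega) hq h
    omega

theorem ncard_multiEdges (hq : 1 ≤ q) [Fintype P] :
    X.network.multiEdges.ncard = Fintype.card P := by
  rw [X.multiEdges_eq hq, ← Set.image_univ, Set.ncard_image_of_injective _ twin_injective,
    Set.ncard_univ, Nat.card_eq_fintype_card]

theorem ncard_multiEdges_line (hq : 1 ≤ q) (l : L) :
    {e | e ∈ X.network.multiEdges ∧ l ∈ X.network.linesOn e}.ncard = q + 1 := by
  have : {e | e ∈ X.network.multiEdges ∧ l ∈ X.network.linesOn e} =
      (fun i => twin P L (X.pt l i)) '' (Finset.range (q + 1) : Set ℕ) := by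
    ext e
    simp only [Set.mem_ofPred_eq, X.multiEdges_eq hq, Set.mem_image, Finset.coe_range, Set.mem_Iio,
      Nat.lt_succ_iff]
    constructor
    · rintro ⟨⟨p, rfl⟩, h⟩
      obtain ⟨i, hi, rfl⟩ := (X.mem_linesOn_twin _ _).1 h
      exact ⟨i, hi, rfl⟩
    · rintro ⟨i, hi, rfl⟩
      exact ⟨⟨_, rfl⟩, (X.mem_linesOn_twin _ _).2 (X.on_pt l hi)⟩
  rw [this, Set.InjOn.ncard_image, Set.ncard_coe_finset, Finset.card_range]
  intro i hi j hj h
  simp only [Finset.coe_range, Set.mem_Iio, Nat.lt_succ_iff] at hi hj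
  exact X.pt_inj l i j hi hj (twin_injective h)

theorem existsUnique_line (hq : 1 ≤ q) (e : Sym2 (Vert P L)) (he : e ∈ X.network.multiEdges)
    (e' : Sym2 (Vert P L)) (he' : e' ∈ X.network.multiEdges) (hne : e ≠ e') :
    ∃! l : L, l ∈ X.network.linesOn e ∧ l ∈ X.network.linesOn e' := by
  rw [X.multiEdges_eq hq] at he he'
  obtain ⟨p, rfl⟩ := he
  obtain ⟨p', rfl⟩ := he'
  have hp : p ≠ p' := fun h => hne (by rw [h])
  simp only [mem_linesOn_twin]
  obtain ⟨l, h1, h2⟩ := X.exists_line p p' hp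
  exact ⟨l, ⟨h1, h2⟩, fun l' h => On.line_unique hp h.1 h.2 h1 h2⟩

theorem pathTerminal : X.network.PathTerminal := by
  refine ⟨fun l => ⟨?_, ?_⟩, ?_⟩
  · exact RotationSystem.ncard_neighborSet_of_neighbors (deg q) X.nb X.nb_adj X.nb_inj X.nb_surj
      (src l)
  · exact RotationSystem.ncard_neighborSet_of_neighbors (deg q) X.nb X.nb_adj X.nb_inj X.nb_surj
      (tgt l)
  · rintro (l | l) (l' | l') h <;> simp_all [network]

/-- The common path is the twin edge of the unique common point; all other edges carry one line, and
the terminals are private. -/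
theorem pathIntersection : X.network.PathIntersection := by
  intro l l' hl
  obtain ⟨p, h, h'⟩ := X.exists_point l l' hl
  replace h : X.On p l := h
  replace h' : X.On p l' := h'
  have huniq : ∀ x, X.On x l → X.On x l' → x = p := fun x h1 h2 =>
    On.point_unique hl h1 h2 h h'
  have hadj : X.network.graph.Adj (inn p) (out p) := X.twin_adj p
  refine .inr ⟨inn p, out p, .cons hadj .nil, ?_, fun v => ?_, fun e => ?_⟩
  · simp
  · rw [mem_support_line, mem_support_line]
    simp only [SimpleGraph.Walk.support_cons, SimpleGraph.Walk.support_nil, List.mem_cons,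
      List.not_mem_nil, or_false]
    constructor
    · intro hv
      exact ⟨.inr (.inr ⟨p, h, hv⟩), .inr (.inr ⟨p, h', hv⟩)⟩
    · rintro ⟨rfl | rfl | ⟨x, hx, rfl | rfl⟩, h2⟩
      · simp [hl] at h2
      · simp [hl] at h2
      · simp only [reduceCtorEq, inn.injEq, or_false, false_or, exists_eq_right'] at h2
        exact .inl (by rw [huniq x hx h2])
      · simp only [reduceCtorEq, out.injEq, false_or, exists_eq_right'] at h2
        exact .inr (by rw [huniq x hx h2])
  · simp only [SimpleGraph.Walk.edges_cons, SimpleGraph.Walk.edges_nil, List.mem_singleton]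
    change e = twin P L p ↔ l ∈ X.network.linesOn e ∧ l' ∈ X.network.linesOn e
    constructor
    · rintro rfl
      exact ⟨(X.mem_linesOn_twin _ _).2 h, (X.mem_linesOn_twin _ _).2 h'⟩
    · rintro ⟨h1, h2⟩
      obtain ⟨x, rfl⟩ | ⟨l₀, h0⟩ := X.twin_or_linesOn_singleton e
        ((X.network.line l).edges_subset_edgeSet h1)
      · rw [huniq x ((X.mem_linesOn_twin _ _).1 h1) ((X.mem_linesOn_twin _ _).1 h2)]
      · rw [h0] at h1 h2
        exact absurd (h1.trans h2.symm) hl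

end OrderedPlane

/-! ### Consistency at the points, and the lower bound. -/

namespace OrderedPlane

open Vert

variable {q : ℕ} {P L : Type} (X : OrderedPlane q P L)

/-- The lines through the point `p`. -/
def linesThrough (p : P) : List L := (List.range (q + 1)).map (X.ln p)

theorem length_linesThrough (p : P) : (X.linesThrough p).length = q + 1 := by
  simp [linesThrough]

theorem mem_linesThrough (p : P) (l : L) : l ∈ X.linesThrough p ↔ X.On p l := by
  simp only [linesThrough, List.mem_map, List.mem_range, Nat.lt_succ_iff]
  exact (X.incident p l).symm

theorem nodup_linesThrough (p : P) : (X.linesThrough p).Nodup := by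
  refine List.Nodup.map_on ?_ List.nodup_range
  intro i hi j hj h
  simp only [List.mem_range, Nat.lt_succ_iff] at hi hj
  exact X.ln_inj p i j hi hj h

open Classical in
/-- The line on an edge that carries exactly one line. -/
noncomputable def single (e : Sym2 (Vert P L)) : List L :=
  if h : ∃ l, X.network.linesOn e = {l} then [h.choose] else []

theorem single_eq {e : Sym2 (Vert P L)} {l : L} (h : X.network.linesOn e = {l}) :
    X.single e = [l] := by
  have h' : ∃ l, X.network.linesOn e = {l} := ⟨l, h⟩
  rw [single, dif_pos h', Set.singleton_injective (h'.choose_spec.symm.trans h)]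

theorem dart_eq_of_edge_eq {V : Type*} {G : SimpleGraph V} {d d' : G.Dart} (h : d.fst = d'.fst)
    (he : d.edge = d'.edge) : d = d' := by
  obtain h' | h' := SimpleGraph.dart_edge_eq_iff d d' |>.1 he
  · exact h'
  · exfalso
    have : d'.fst = d'.snd := by rw [← h, h']; rfl
    exact d'.adj.ne this

/-- The vertex `v` is one of the two vertices of the point `p`. -/
def AtPoint (p : P) (v : Vert P L) : Prop := v = inn p ∨ v = out p

variable {X}

theorem AtPoint.edge_cases {p : P} {d : X.network.graph.Dart} (h : AtPoint p d.fst) :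
    d.edge = twin P L p ∨ ∃ l, X.On p l ∧ X.network.linesOn d.edge = {l} := by
  obtain ⟨⟨u, v⟩, hd⟩ := d
  obtain rfl | rfl : u = inn p ∨ u = out p := h
  · obtain rfl | ⟨l, hl, rfl⟩ := (X.inn_adj p v).1 hd
    · exact .inl rfl
    · exact .inr ⟨l, hl, X.linesOn_prevAt p l hl⟩
  · obtain rfl | ⟨l, hl, rfl⟩ := (X.out_adj p v).1 hd
    · exact .inl Sym2.eq_swap
    · exact .inr ⟨l, hl, X.linesOn_nextAt p l hl⟩

theorem linesOn_twin_ne (hq : 1 ≤ q) (p : P) (l : L) :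
    X.network.linesOn (twin P L p) ≠ {l} := by
  intro h
  have h1 : twin P L p ∈ X.network.multiEdges := by rw [X.multiEdges_eq hq]; exact ⟨p, rfl⟩
  have h2 := h1.2
  rw [h] at h2
  exact Set.not_nontrivial_singleton h2

/-- At a vertex of a point each line leaves, apart from the twin edge, along an edge of its own. -/
theorem AtPoint.dart_unique (hq : 1 ≤ q) {p : P} {d d' : X.network.graph.Dart} {l : L}
    (h : AtPoint p d.fst) (hdd : d.fst = d'.fst) (hd : X.network.linesOn d.edge = {l})
    (hd' : X.network.linesOn d'.edge = {l}) : d = d' := by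
  obtain ⟨⟨u, v⟩, huv⟩ := d
  obtain ⟨⟨u', v'⟩, huv'⟩ := d'
  obtain rfl : u = u' := hdd
  obtain rfl | rfl : u = inn p ∨ u = out p := h
  · obtain rfl | ⟨m, hm, rfl⟩ := (X.inn_adj p v).1 huv
    · exact absurd hd (linesOn_twin_ne hq p l)
    obtain rfl | ⟨m', hm', rfl⟩ := (X.inn_adj p v').1 huv'
    · exact absurd hd' (linesOn_twin_ne hq p l)
    obtain rfl := Set.singleton_injective ((X.linesOn_prevAt p m hm).symm.trans hd)
    obtain rfl := Set.singleton_injective ((X.linesOn_prevAt p m' hm').symm.trans hd')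
    rfl
  · obtain rfl | ⟨m, hm, rfl⟩ := (X.out_adj p v).1 huv
    · change X.network.linesOn s(out p, inn p) = {l} at hd
      rw [Sym2.eq_swap] at hd
      exact absurd hd (linesOn_twin_ne hq p l)
    obtain rfl | ⟨m', hm', rfl⟩ := (X.out_adj p v').1 huv'
    · change X.network.linesOn s(out p, inn p) = {l} at hd'
      rw [Sym2.eq_swap] at hd'
      exact absurd hd' (linesOn_twin_ne hq p l)
    obtain rfl := Set.singleton_injective ((X.linesOn_nextAt p m hm).symm.trans hd)
    obtain rfl := Set.singleton_injective ((X.linesOn_nextAt p m' hm').symm.trans hd')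
    rfl

variable (X)

theorem mem_others (d d' : X.network.graph.Dart) :
    d' ∈ X.network.rot.others d ↔ d'.fst = d.fst ∧ d' ≠ d :=
  RotationSystem.mem_ofNeighbors_others (deg q) X.nb X.nb_adj X.nb_inj X.nb_surj d d'

theorem nodup_others (d : X.network.graph.Dart) : (X.network.rot.others d).Nodup :=
  RotationSystem.ofNeighbors_others_nodup (deg q) X.nb X.nb_adj X.nb_inj X.nb_surj d

/-- At both vertices of a point, the lines leave in the given order. -/
theorem flatMap_others (p : P) (d : X.network.graph.Dart) (hp : AtPoint p d.fst)
    (hd : d.edge = twin P L p) (f : X.network.graph.Dart → List L)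
    (hf : ∀ d' ∈ X.network.rot.others d, f d' = X.single d'.edge) :
    (X.network.rot.others d).flatMap f = X.linesThrough p := by
  have hsnd : d.snd = X.nb d.fst 0 ∧ deg q d.fst = q + 1 ∧
      ∀ k ≤ q, X.single s(d.fst, X.nb d.fst (k + 1)) = [X.ln p k] := by
    obtain ⟨⟨u, v⟩, huv⟩ := d
    obtain rfl | rfl : u = inn p ∨ u = out p := hp
    · obtain rfl : out p = v := by simpa [twin, SimpleGraph.Dart.edge, eq_comm] using hd
      exact ⟨rfl, rfl, fun k hk => X.single_eq (X.linesOn_prevAt p _ (X.on_ln p hk))⟩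
    · obtain rfl : inn p = v := by simpa [twin, SimpleGraph.Dart.edge, eq_comm] using hd
      exact ⟨rfl, rfl, fun k hk => X.single_eq (X.linesOn_nextAt p _ (X.on_ln p hk))⟩
  have h1 : (X.network.rot.others d).flatMap f =
      ((X.network.rot.others d).map fun d' => d'.toProd).flatMap fun x => X.single s(x.1, x.2) := by
    rw [List.flatMap_map]
    exact List.flatMap_congr hf
  have h2 : (X.network.rot.others d).map (fun d' => d'.toProd) =
      (List.range (deg q d.fst)).map fun k => (d.fst, X.nb d.fst (k + 1)) :=
    RotationSystem.ofNeighbors_others_toProd (deg q) X.nb X.nb_adj X.nb_inj X.nb_surj d hsnd.1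
  rw [h1, h2, hsnd.2.1, List.flatMap_map, linesThrough, List.map_eq_flatMap]
  refine List.flatMap_congr fun k hk => ?_
  exact hsnd.2.2 k (Nat.lt_succ_iff.1 (List.mem_range.1 hk))

variable {X}

theorem ord_eq_singleton (S : X.network.LineOrders) {d : X.network.graph.Dart} {l : L}
    (h : X.network.linesOn d.edge = {l}) {i : ℕ} (hi : i ≤ S.t d.edge) : S.ord d i = [l] := by
  have h1 : ∀ m, m ∈ S.ord d i ↔ m ∈ [l] := by
    intro m
    rw [S.mem_iff d i hi, h, List.mem_singleton, Set.mem_singleton_iff]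
  exact List.perm_singleton.1 ((List.perm_ext_iff_of_nodup (S.nodup d i hi)
    (List.nodup_singleton l)).2 h1)

-- Each remaining edge at the vertex carries one line, and that line passes through `p`. So the
-- filter in the consistency condition removes nothing, and the right side does not depend on the
-- solution.
open Classical in
theorem filter_ord_others (S : X.network.LineOrders) (p : P) (d : X.network.graph.Dart)
    (hp : AtPoint p d.fst) (hd : d.edge = twin P L p) (d' : X.network.graph.Dart)
    (hd' : d' ∈ X.network.rot.others d) :
    (S.ord d' 0).filter (fun l => l ∈ X.network.linesOn d.edge) = X.single d'.edge := by
  obtain ⟨h1, h2⟩ := (X.mem_others d d').1 hd'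
  obtain h | ⟨l, hl, h⟩ := AtPoint.edge_cases (X := X) (d := d') (h1 ▸ hp)
  · exact absurd (dart_eq_of_edge_eq h1 (h.trans hd.symm)) h2
  · rw [ord_eq_singleton S h (Nat.zero_le _), X.single_eq h]
    simp [hd, mem_linesOn_twin, hl]

theorem AtPoint.ne_terminal {p : P} {v : Vert P L} (h : AtPoint p v) (l : L) :
    X.network.src l ≠ v ∧ X.network.tgt l ≠ v := by
  obtain rfl | rfl := h <;> constructor <;> intro h' <;> cases h'

/-- In a consistent solution, the order close to a vertex of a point is determined by the order
in which the lines leave. -/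
theorem ord_reverse_of_consistent (S : X.network.LineOrders) (hS : S.Consistent) (p : P)
    (d : X.network.graph.Dart) (hp : AtPoint p d.fst) (hd : d.edge = twin P L p) :
    (S.ord d 0).reverse = X.linesThrough p := by
  have h := hS d
  rw [X.flatMap_others p d hp hd _ fun d' hd' => filter_ord_others S p d hp hd d' hd'] at h
  rw [← h, eq_comm, List.filter_eq_self]
  intro l _
  simpa using hp.ne_terminal (X := X) l

/-- Consistency at both ends of the twin edge prescribes the same list; since opposite darts see
mirrored orders, the orders along the edge run from the reverse of that list to the list itself. -/
theorem le_three_mul_t (S : X.network.LineOrders) (hS : S.Consistent) (p : P) :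
    q ≤ 3 * S.t (twin P L p) := by
  let d : X.network.graph.Dart := ⟨(inn p, out p), X.twin_adj p⟩
  have hd : d.edge = twin P L p := rfl
  have hd' : d.symm.edge = twin P L p := Sym2.eq_swap
  have h1 := ord_reverse_of_consistent S hS p d (.inl rfl) hd
  have h2 := ord_reverse_of_consistent S hS p d.symm (.inr rfl) hd'
  rw [S.ord_symm d 0 (Nat.zero_le _), Nat.sub_zero, List.reverse_reverse] at h2
  have := length_le_of_blockMoves_reverse (X.nodup_linesThrough p) (S.ord d) (S.t d.edge)
    (by rw [← h1, List.reverse_reverse]) h2 (S.move d)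
  rw [length_linesThrough, hd] at this
  omega

theorem le_blockCrossings [Fintype P] [Fintype L] (S : X.network.LineOrders)
    (hS : S.Consistent) : Fintype.card P * q ≤ 3 * S.blockCrossings := by
  classical
  have hfin : X.network.graph.edgeSet.Finite := Set.toFinite _
  have h1 : ∑ p : P, S.t (twin P L p) ≤ S.blockCrossings := by
    rw [LineNetwork.LineOrders.blockCrossings, finsum_mem_eq_finite_toFinset_sum _ hfin,
      ← Finset.sum_image (f := S.t) (s := Finset.univ) (g := twin P L)
        fun _ _ _ _ h => twin_injective h]
    refine Finset.sum_le_sum_of_subset fun e he => ?_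
    obtain ⟨p, -, rfl⟩ := Finset.mem_image.1 he
    exact hfin.mem_toFinset.2 (X.twin_mem_edgeSet p)
  have h2 : ∑ _p : P, q ≤ ∑ p : P, 3 * S.t (twin P L p) :=
    Finset.sum_le_sum fun p _ => le_three_mul_t S hS p
  rw [Finset.sum_const, Finset.card_univ, smul_eq_mul, ← Finset.mul_sum] at h2
  omega

/-! ### A monotone solution with q block crossings for each point. -/

variable (X)

open Classical in
/-- The number of block moves in the solution that reverses the lines of every point one by one. -/
noncomputable def solutionT (q : ℕ) {P L : Type} (e : Sym2 (Vert P L)) : ℕ :=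
  if ∃ p, e = twin P L p then q else 0

theorem solutionT_twin (p : P) : solutionT q (twin P L p) = q := if_pos ⟨p, rfl⟩

theorem solutionT_of_singleton (hq : 1 ≤ q) {e : Sym2 (Vert P L)} {l : L}
    (h : X.network.linesOn e = {l}) : solutionT q e = 0 :=
  if_neg <| by
    rintro ⟨p, rfl⟩
    exact linesOn_twin_ne hq p l h

/-- The orders on the edge of a point in the solution that reverses its lines one by one. -/
def stage (p : P) (i : ℕ) : List L := (X.linesThrough p).reverse.reverseStage i

/-- The orders in the solution that reverses the lines of every point one by one. -/
noncomputable def solutionOrd (u v : Vert P L) (i : ℕ) : List L :=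
  match u, v with
  | inn p, out x => open Classical in if p = x then X.stage p i else X.single s(inn p, out x)
  | out p, inn x => open Classical in
      if p = x then (X.stage p (q - i)).reverse else X.single s(out p, inn x)
  | u, v => X.single s(u, v)

theorem solutionOrd_inn_out (p : P) (i : ℕ) : X.solutionOrd (inn p) (out p) i = X.stage p i :=
  if_pos rfl

theorem solutionOrd_out_inn (p : P) (i : ℕ) :
    X.solutionOrd (out p) (inn p) i = (X.stage p (q - i)).reverse :=
  if_pos rfl

theorem solutionOrd_of_singleton (hq : 1 ≤ q) {u v : Vert P L} {l : L}
    (h : X.network.linesOn s(u, v) = {l}) (i : ℕ) : X.solutionOrd u v i = [l] := by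
  have key : ∀ p, s(u, v) ≠ twin P L p := by
    intro p hp
    rw [hp] at h
    exact linesOn_twin_ne hq p l h
  have : X.solutionOrd u v i = X.single s(u, v) := by
    unfold solutionOrd
    split
    · refine if_neg ?_
      rintro rfl
      exact key _ rfl
    · refine if_neg ?_
      rintro rfl
      exact key _ Sym2.eq_swap
    · rfl
  rw [this, X.single_eq h]

theorem stage_perm (p : P) (i : ℕ) : (X.stage p i).Perm (X.linesThrough p) :=
  (List.reverseStage_perm _ _).trans (List.reverse_perm _)

theorem dart_cases (d : X.network.graph.Dart) :
    (∃ p, d.toProd = (inn p, out p)) ∨ (∃ p, d.toProd = (out p, inn p)) ∨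
      ∃ l, X.network.linesOn s(d.fst, d.snd) = {l} := by
  obtain ⟨⟨u, v⟩, huv⟩ := d
  obtain ⟨p, h⟩ | h := X.twin_or_linesOn_singleton s(u, v) huv
  · obtain ⟨rfl, rfl⟩ | ⟨rfl, rfl⟩ := Sym2.eq_iff.1 h
    · exact .inl ⟨p, rfl⟩
    · exact .inr (.inl ⟨p, rfl⟩)
  · exact .inr (.inr h)

theorem blockMove_stage (p : P) {i : ℕ} (hi : i < q) :
    BlockMove (X.stage p i) (X.stage p (i + 1)) :=
  List.blockMove_reverseStage (by rw [List.length_reverse, length_linesThrough]; omega)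

/-- The solution that reverses the lines of every point one by one. -/
noncomputable def solution (hq : 1 ≤ q) : X.network.LineOrders where
  t := solutionT q
  ord d i := X.solutionOrd d.fst d.snd i
  nodup := by
    rintro d i -
    obtain ⟨p, h⟩ | ⟨p, h⟩ | ⟨l, h⟩ := X.dart_cases d
    · rw [h, solutionOrd_inn_out, (X.stage_perm p i).nodup_iff]
      exact X.nodup_linesThrough p
    · rw [h, solutionOrd_out_inn, List.nodup_reverse, (X.stage_perm p _).nodup_iff]
      exact X.nodup_linesThrough p
    · rw [X.solutionOrd_of_singleton hq h]
      exact List.nodup_singleton l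
  mem_iff := by
    rintro ⟨⟨u, v⟩, huv⟩ i - l
    obtain ⟨p, h⟩ | ⟨p, h⟩ | ⟨l, h⟩ := X.dart_cases ⟨⟨u, v⟩, huv⟩
    · obtain ⟨rfl, rfl⟩ := Prod.ext_iff.1 h
      change l ∈ X.solutionOrd (inn p) (out p) i ↔ l ∈ X.network.linesOn (twin P L p)
      rw [solutionOrd_inn_out, (X.stage_perm p i).mem_iff, mem_linesThrough, mem_linesOn_twin]
    · obtain ⟨rfl, rfl⟩ := Prod.ext_iff.1 h
      change l ∈ X.solutionOrd (out p) (inn p) i ↔ l ∈ X.network.linesOn s(out p, inn p)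
      rw [Sym2.eq_swap, solutionOrd_out_inn, List.mem_reverse, (X.stage_perm p _).mem_iff,
        mem_linesThrough]
      exact (X.mem_linesOn_twin p l).symm
    · change _ ↔ _ ∈ X.network.linesOn s(u, v)
      rw [X.solutionOrd_of_singleton hq h]
      replace h : X.network.linesOn s(u, v) = _ := h
      rw [h, List.mem_singleton, Set.mem_singleton_iff]
  move := by
    rintro ⟨⟨u, v⟩, huv⟩ i hi
    obtain ⟨p, h⟩ | ⟨p, h⟩ | ⟨l, h⟩ := X.dart_cases ⟨⟨u, v⟩, huv⟩
    · obtain ⟨rfl, rfl⟩ := Prod.ext_iff.1 h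
      replace hi : i < solutionT q (twin P L p) := hi
      rw [solutionT_twin] at hi
      change BlockMove (X.solutionOrd (inn p) (out p) i) (X.solutionOrd (inn p) (out p) (i + 1))
      rw [solutionOrd_inn_out, solutionOrd_inn_out]
      exact X.blockMove_stage p hi
    · obtain ⟨rfl, rfl⟩ := Prod.ext_iff.1 h
      replace hi : i < solutionT q s(out p, inn p) := hi
      rw [Sym2.eq_swap] at hi
      replace hi : i < solutionT q (twin P L p) := hi
      rw [solutionT_twin] at hi
      change BlockMove (X.solutionOrd (out p) (inn p) i) (X.solutionOrd (out p) (inn p) (i + 1))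
      rw [solutionOrd_out_inn, solutionOrd_out_inn]
      -- Along the opposite dart both time and orders are reversed, so move `i` mirrors the move out
      -- of stage `q - (i + 1)`.
      have := (X.blockMove_stage p (i := q - (i + 1)) (by omega)).reverse
      rwa [show q - (i + 1) + 1 = q - i by omega] at this
    · replace hi : i < solutionT q s(u, v) := hi
      rw [X.solutionT_of_singleton hq h] at hi
      omega
  ord_symm := by
    rintro ⟨⟨u, v⟩, huv⟩ i hi
    obtain ⟨p, h⟩ | ⟨p, h⟩ | ⟨l, h⟩ := X.dart_cases ⟨⟨u, v⟩, huv⟩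
    · obtain ⟨rfl, rfl⟩ := Prod.ext_iff.1 h
      change X.solutionOrd (out p) (inn p) i =
        (X.solutionOrd (inn p) (out p) (solutionT q (twin P L p) - i)).reverse
      rw [solutionOrd_inn_out, solutionOrd_out_inn, solutionT_twin]
    · obtain ⟨rfl, rfl⟩ := Prod.ext_iff.1 h
      replace hi : i ≤ solutionT q s(out p, inn p) := hi
      change X.solutionOrd (inn p) (out p) i =
        (X.solutionOrd (out p) (inn p) (solutionT q s(out p, inn p) - i)).reverse
      rw [Sym2.eq_swap] at hi ⊢
      change i ≤ solutionT q (twin P L p) at hi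
      change _ = (X.solutionOrd (out p) (inn p) (solutionT q (twin P L p) - i)).reverse
      rw [solutionT_twin] at hi ⊢
      rw [solutionOrd_inn_out, solutionOrd_out_inn, List.reverse_reverse]
      rw [show q - (q - i) = i by omega]
    · change X.solutionOrd v u i = (X.solutionOrd u v _).reverse
      rw [X.solutionOrd_of_singleton hq h,
        X.solutionOrd_of_singleton hq (by rw [Sym2.eq_swap]; exact h)]
      rfl

theorem others_eq_nil (d : X.network.graph.Dart) (h : ∀ p, ¬ AtPoint p d.fst) :
    X.network.rot.others d = [] := by
  rw [List.eq_nil_iff_forall_not_mem]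
  intro d' hd'
  obtain ⟨h1, h2⟩ := (X.mem_others d d').1 hd'
  obtain ⟨⟨u, v⟩, huv⟩ := d
  obtain ⟨⟨u', v'⟩, huv'⟩ := d'
  obtain rfl : u' = u := h1
  cases u' with
  | inn p => exact h p (.inl rfl)
  | out p => exact h p (.inr rfl)
  | src l =>
    obtain rfl := (X.src_adj l v).1 huv
    obtain rfl := (X.src_adj l v').1 huv'
    exact h2 rfl
  | tgt l =>
    obtain rfl := (X.tgt_adj l v).1 huv
    obtain rfl := (X.tgt_adj l v').1 huv'
    exact h2 rfl

/-- On the twin edge both extreme stages are the prescribed orders. On another edge at a point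
vertex, its only line continues on the twin edge and on no further edge. At a terminal both sides
are empty, because the only line ends there. -/
theorem consistent_solution (hq : 1 ≤ q) : (X.solution hq).Consistent := by
  classical
  intro d
  by_cases hp : ∃ p, AtPoint p d.fst
  · obtain ⟨p, hp⟩ := hp
    have hfil : ((X.solution hq).ord d 0).reverse.filter
        (fun l => X.network.src l ≠ d.fst ∧ X.network.tgt l ≠ d.fst) =
          ((X.solution hq).ord d 0).reverse := by
      rw [List.filter_eq_self]
      intro l _
      simpa using hp.ne_terminal (X := X) l
    refine Eq.trans (by convert hfil) ?_
    obtain hd | ⟨l, hl, hd⟩ := AtPoint.edge_cases (X := X) hp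
    · rw [X.flatMap_others p d hp hd _ fun d' hd' =>
        filter_ord_others (X.solution hq) p d hp hd d' hd']
      obtain ⟨⟨u, v⟩, huv⟩ := d
      change (X.solutionOrd u v 0).reverse = _
      obtain ⟨rfl, rfl⟩ | ⟨rfl, rfl⟩ := Sym2.eq_iff.1 hd
      · rw [solutionOrd_inn_out, stage, List.reverseStage_zero, List.reverse_reverse]
      · rw [solutionOrd_out_inn, stage, List.reverse_reverse, Nat.sub_zero,
          List.reverseStage_of_length_le
            (by rw [List.length_reverse, length_linesThrough]), List.reverse_reverse]
    · obtain ⟨d₀, h0, he⟩ : ∃ d₀ : X.network.graph.Dart, d₀.fst = d.fst ∧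
          d₀.edge = twin P L p := by
        obtain h | h := hp
        · exact ⟨⟨(inn p, out p), X.twin_adj p⟩, h.symm, rfl⟩
        · exact ⟨⟨(out p, inn p), (X.twin_adj p).symm⟩, h.symm, Sym2.eq_swap⟩
      have hne : d₀ ≠ d := by
        rintro rfl
        rw [he] at hd
        exact linesOn_twin_ne hq p l hd
      rw [List.flatMap_eq_of_forall_ne (X.nodup_others d)
        ((X.mem_others d d₀).2 ⟨h0, hne⟩)]
      · rw [ord_eq_singleton _ hd (Nat.zero_le _)]
        simp only [hd, Set.mem_singleton_iff, List.reverse_singleton]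
        have hmem : l ∈ (X.solution hq).ord d₀ 0 := by
          rw [(X.solution hq).mem_iff d₀ 0 (Nat.zero_le _), he, mem_linesOn_twin]
          exact hl
        have hnd := (X.solution hq).nodup d₀ 0 (Nat.zero_le _)
        symm
        rw [← List.perm_singleton, List.perm_ext_iff_of_nodup (hnd.filter _)
          (List.nodup_singleton l)]
        intro m
        simp only [List.mem_filter, decide_eq_true_eq, List.mem_singleton]
        exact ⟨fun h => h.2, by rintro rfl; exact ⟨hmem, rfl⟩⟩
      · intro d' hd' hne'
        obtain ⟨h1, h2⟩ := (X.mem_others d d').1 hd'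
        obtain h | ⟨m, hm, h⟩ := AtPoint.edge_cases (X := X) (d := d') (h1 ▸ hp)
        · exact absurd (dart_eq_of_edge_eq (h1.trans h0.symm) (h.trans he.symm)) hne'
        · rw [ord_eq_singleton _ h (Nat.zero_le _), hd]
          have : m ≠ l := by
            rintro rfl
            exact h2 (AtPoint.dart_unique hq hp h1.symm hd h).symm
          simp [this]
  · push Not at hp
    rw [X.others_eq_nil d hp, List.flatMap_nil, List.filter_eq_nil_iff]
    intro l hl
    rw [List.mem_reverse, (X.solution hq).mem_iff d 0 (Nat.zero_le _)] at hl
    obtain ⟨⟨u, v⟩, huv⟩ := d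
    replace hl : l ∈ X.network.linesOn s(u, v) := hl
    cases u with
    | inn p => exact absurd (.inl rfl) (hp p)
    | out p => exact absurd (.inr rfl) (hp p)
    | src m =>
      obtain rfl := (X.src_adj m v).1 huv
      rw [linesOn_src, Set.mem_singleton_iff] at hl
      subst hl
      simp [network]
    | tgt m =>
      obtain rfl := (X.tgt_adj m v).1 huv
      rw [Sym2.eq_swap, linesOn_tgt, Set.mem_singleton_iff] at hl
      subst hl
      simp [network]

-- Two lines can only cross on the twin edge of their common point, and there the larger of their
-- positions in the initial list gives the time of the crossing. The two alternatives are the two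
-- directions of traversal.
open Classical in
theorem crosses_solution (hq : 1 ≤ q) {l l' : L} (hl : l ≠ l') {d : X.network.graph.Dart} {i : ℕ}
    (h : (X.solution hq).Crosses l l' d i) :
    ∃ p, X.On p l ∧ X.On p l' ∧ d.edge = twin P L p ∧ i < q ∧
      (d.fst = inn p ∧ i + 1 = max ((X.linesThrough p).reverse.idxOf l)
          ((X.linesThrough p).reverse.idxOf l') ∨
       d.fst = out p ∧ q - i = max ((X.linesThrough p).reverse.idxOf l)
          ((X.linesThrough p).reverse.idxOf l')) := by
  obtain ⟨hi, hsub⟩ := h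
  have hmem : l ∈ X.network.linesOn d.edge ∧ l' ∈ X.network.linesOn d.edge := by
    rw [← (X.solution hq).mem_iff d i hi.le, ← (X.solution hq).mem_iff d i hi.le]
    rcases hsub with h | h
    · exact ⟨h.1.subset (by simp), h.1.subset (by simp)⟩
    · exact ⟨h.1.subset (by simp), h.1.subset (by simp)⟩
  have swap : ∀ (p : P) (j : ℕ), j < q →
      ([l, l'].Sublist (X.stage p j) ∧ [l', l].Sublist (X.stage p (j + 1)) ∨
        [l', l].Sublist (X.stage p j) ∧ [l, l'].Sublist (X.stage p (j + 1))) →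
      j + 1 = max ((X.linesThrough p).reverse.idxOf l)
          ((X.linesThrough p).reverse.idxOf l') := by
    intro p j hj h
    have hn := List.nodup_reverse.2 (X.nodup_linesThrough p)
    have hlen : j + 1 < (X.linesThrough p).reverse.length := by
      rw [List.length_reverse, length_linesThrough]; omega
    rcases h with h | h
    · exact hn.max_idxOf_of_swap_reverseStage hlen hl h.1 h.2
    · rw [max_comm]
      exact hn.max_idxOf_of_swap_reverseStage hlen hl.symm h.1 h.2
  obtain ⟨⟨u, v⟩, huv⟩ := d
  obtain ⟨p, h⟩ | ⟨p, h⟩ | ⟨m, h⟩ := X.dart_cases ⟨⟨u, v⟩, huv⟩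
  · obtain ⟨rfl, rfl⟩ := Prod.ext_iff.1 h
    replace hi : i < solutionT q (twin P L p) := hi
    rw [solutionT_twin] at hi
    refine ⟨p, (X.mem_linesOn_twin p l).1 hmem.1, (X.mem_linesOn_twin p l').1 hmem.2, rfl, hi,
      .inl ⟨rfl, swap p i hi ?_⟩⟩
    change _ ∧ _ ∨ _ ∧ _ at hsub
    simp only [solution, solutionOrd_inn_out] at hsub
    exact hsub
  · obtain ⟨rfl, rfl⟩ := Prod.ext_iff.1 h
    have hedge : s(out p, inn p) = twin P L p := Sym2.eq_swap
    replace hi : i < solutionT q s(out p, inn p) := hi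
    change l ∈ X.network.linesOn s(out p, inn p) ∧ l' ∈ X.network.linesOn s(out p, inn p) at hmem
    rw [hedge, solutionT_twin] at hi
    rw [hedge, mem_linesOn_twin, mem_linesOn_twin] at hmem
    refine ⟨p, hmem.1, hmem.2, hedge, hi, .inr ⟨rfl, ?_⟩⟩
    rw [show q - i = q - (i + 1) + 1 by omega]
    refine swap p (q - (i + 1)) (by omega) ?_
    rw [show q - (i + 1) + 1 = q - i by omega]
    simp only [solution, solutionOrd_out_inn] at hsub
    have rev : ∀ (a b : L) (x : List L), [a, b].Sublist x.reverse ↔ [b, a].Sublist x := by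
      intro a b x
      rw [← List.reverse_sublist, List.reverse_reverse]
      rfl
    simp only [rev] at hsub
    tauto
  · replace h : X.network.linesOn s(u, v) = {m} := h
    change l ∈ X.network.linesOn s(u, v) ∧ l' ∈ X.network.linesOn s(u, v) at hmem
    rw [h] at hmem
    exact absurd (hmem.1.trans hmem.2.symm) hl

theorem monotone_solution (hq : 1 ≤ q) : (X.solution hq).Monotone := by
  intro l l' hl d i d' i' h h'
  obtain ⟨p, h1, h2, h3, h4, h5⟩ := X.crosses_solution hq hl h
  obtain ⟨p', h1', h2', h3', h4', h5'⟩ := X.crosses_solution hq hl h'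
  obtain rfl := On.point_unique hl h1 h2 h1' h2'
  refine ⟨h3.trans h3'.symm, ?_⟩
  rintro rfl
  -- For equal directions both times are determined by the same maximum; opposite directions are
  -- impossible for one dart.
  rcases h5 with ⟨e, h5⟩ | ⟨e, h5⟩ <;> rcases h5' with ⟨e', h5'⟩ | ⟨e', h5'⟩
  · omega
  · rw [e] at e'; cases e'
  · rw [e] at e'; cases e'
  · omega

theorem blockCrossings_solution [Fintype P] (hq : 1 ≤ q) :
    (X.solution hq).blockCrossings = Fintype.card P * q := by
  classical
  rw [LineNetwork.LineOrders.blockCrossings,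
    finsum_mem_eq_sum_of_inter_support_eq (t := Finset.univ.image (twin P L)),
    Finset.sum_image fun _ _ _ _ h => twin_injective h]
  · change ∑ p : P, solutionT q (twin P L p) = _
    simp [solutionT_twin]
  · ext e
    constructor
    · rintro ⟨-, h⟩
      refine ⟨?_, h⟩
      by_contra hn
      refine h (if_neg ?_)
      rintro ⟨p, rfl⟩
      exact hn (by simp)
    · rintro ⟨h, h'⟩
      refine ⟨?_, h'⟩
      simp only [Finset.coe_image, Finset.coe_univ, Set.image_univ, Set.mem_range] at h
      obtain ⟨p, rfl⟩ := h
      exact X.twin_mem_edgeSet p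

end OrderedPlane

/-! ### Nonplanarity by counting faces. -/

namespace OrderedPlane

open Vert RotationSystem

variable {q : ℕ} {P L : Type} (X : OrderedPlane q P L)

/-- The vertices that belong to points. -/
def core (P L : Type) : Set (Vert P L) := {v | ∃ p, AtPoint p v}

theorem inn_mem_core (p : P) : (inn p : Vert P L) ∈ core P L := ⟨p, .inl rfl⟩

theorem out_mem_core (p : P) : (out p : Vert P L) ∈ core P L := ⟨p, .inr rfl⟩

/-- There is an edge from `p` to `x`. -/
def Link (p x : P) : Prop := x = p ∨ X.Step p x

theorem link_iff (p x : P) : X.Link p x ↔ X.graph.Adj (out p) (inn x) := by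
  rw [graph_adj, or_comm]
  rfl

theorem dart_eq_of_notMem_core (d d' : X.graph.Dart) (h : d.fst ∉ core P L)
    (hd : d.fst = d'.fst) : d = d' := by
  obtain ⟨⟨u, v⟩, huv⟩ := d
  obtain ⟨⟨u', v'⟩, huv'⟩ := d'
  obtain rfl : u = u' := hd
  cases u with
  | inn p => exact absurd (inn_mem_core p) h
  | out p => exact absurd (out_mem_core p) h
  | src l =>
    obtain rfl := (X.src_adj l v).1 huv
    obtain rfl := (X.src_adj l v').1 huv'
    rfl
  | tgt l =>
    obtain rfl := (X.tgt_adj l v).1 huv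
    obtain rfl := (X.tgt_adj l v').1 huv'
    rfl

/-- The dart from `p` to `x`. -/
def linkDart {p x : P} (h : X.Link p x) : X.graph.Dart := ⟨(out p, inn x), (X.link_iff p x).1 h⟩

theorem isInner_linkDart {p x : P} (h : X.Link p x) : IsInner (core P L) (X.linkDart h) :=
  ⟨out_mem_core p, inn_mem_core x⟩

theorem isInner_cases (d : X.graph.Dart) (hd : IsInner (core P L) d) :
    ∃ (p x : P) (h : X.Link p x), d = X.linkDart h ∨ d = (X.linkDart h).symm := by
  obtain ⟨⟨u, v⟩, huv⟩ := d
  obtain ⟨⟨p, rfl | rfl⟩, ⟨x, rfl | rfl⟩⟩ : u ∈ core P L ∧ v ∈ core P L := hd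
  · exact absurd huv (by simp [graph_adj, Arc])
  · exact ⟨x, p, (X.link_iff x p).2 huv.symm, .inr rfl⟩
  · exact ⟨p, x, (X.link_iff p x).2 huv, .inl rfl⟩
  · exact absurd huv (by simp [graph_adj, Arc])

theorem exists_isInner (v : Vert P L) (hv : v ∈ core P L) :
    ∃ y : X.graph.Dart, IsInner (core P L) y ∧ y.fst = v := by
  obtain ⟨p, rfl | rfl⟩ := hv
  · exact ⟨(X.linkDart (.inl rfl : X.Link p p)).symm, (X.isInner_linkDart _).symm, rfl⟩
  · exact ⟨X.linkDart (.inl rfl : X.Link p p), X.isInner_linkDart _, rfl⟩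

theorem fst_or_snd_mem_core (d : X.graph.Dart) : d.fst ∈ core P L ∨ d.snd ∈ core P L := by
  obtain ⟨⟨u, v⟩, huv⟩ := d
  cases u with
  | inn p => exact .inl (inn_mem_core p)
  | out p => exact .inl (out_mem_core p)
  | src l =>
    obtain rfl := (X.src_adj l v).1 huv
    exact .inr (inn_mem_core _)
  | tgt l =>
    obtain rfl := (X.tgt_adj l v).1 huv
    exact .inr (out_mem_core _)

/-- The bipartition of the core. -/
def IsInn (v : Vert P L) : Prop := ∃ p, v = inn p

theorem isInn_iff (d : X.graph.Dart) (hd : IsInner (core P L) d) :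
    IsInn d.fst ↔ ¬ IsInn d.snd := by
  obtain ⟨p, x, h, rfl | rfl⟩ := X.isInner_cases d hd <;> simp [linkDart, IsInn]

/-- The two vertices of a point are not both leaves of the core. -/
theorem exists_ne_of_isInner (hq : 1 ≤ q) (d : X.graph.Dart) (hd : IsInner (core P L) d) :
    (∃ z, IsInner (core P L) z ∧ z.fst = d.fst ∧ z ≠ d) ∨
      ∃ z, IsInner (core P L) z ∧ z.fst = d.snd ∧ z ≠ d.symm := by
  have twin_case : ∀ p : P, (∃ x, x ≠ p ∧ X.Link p x) ∨ ∃ x, x ≠ p ∧ X.Link x p := by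
    intro p
    obtain ⟨i, hi, hp⟩ := X.on_ln p (Nat.zero_le q)
    rcases i with _ | i
    · refine .inl ⟨X.pt (X.ln p 0) 1, fun h => ?_,
        .inr ⟨X.ln p 0, 0, by omega, hp, rfl⟩⟩
      have := X.pt_inj _ 0 1 hi (by omega) (hp.trans h.symm)
      omega
    · refine .inr ⟨X.pt (X.ln p 0) i, fun h => ?_,
        .inr ⟨X.ln p 0, i, by omega, rfl, hp⟩⟩
      have := X.pt_inj _ (i + 1) i hi (by omega) (hp.trans h.symm)
      omega
  obtain ⟨p, x, h, rfl | rfl⟩ := X.isInner_cases d hd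
  · by_cases hpx : x = p
    · subst hpx
      obtain ⟨y, hy, hl⟩ | ⟨y, hy, hl⟩ := twin_case x
      · refine .inl ⟨X.linkDart hl, X.isInner_linkDart hl, rfl, fun h => ?_⟩
        exact hy (inn.inj (congrArg (fun d => d.snd) h))
      · refine .inr ⟨(X.linkDart hl).symm, (X.isInner_linkDart hl).symm, rfl, fun h => ?_⟩
        exact hy (out.inj (congrArg (fun d => d.snd) h))
    · refine .inl ⟨X.linkDart (.inl rfl : X.Link p p), X.isInner_linkDart _, rfl, fun h => ?_⟩
      exact hpx (inn.inj (congrArg (fun d => d.snd) h)).symm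
  · by_cases hpx : x = p
    · subst hpx
      obtain ⟨y, hy, hl⟩ | ⟨y, hy, hl⟩ := twin_case x
      · refine .inr ⟨X.linkDart hl, X.isInner_linkDart hl, rfl, fun h => ?_⟩
        exact hy (inn.inj (congrArg (fun d => d.snd) h))
      · refine .inl ⟨(X.linkDart hl).symm, (X.isInner_linkDart hl).symm, rfl, fun h => ?_⟩
        exact hy (out.inj (congrArg (fun d => d.snd) h))
    · refine .inl ⟨(X.linkDart (.inl rfl : X.Link x x)).symm, (X.isInner_linkDart _).symm,
        rfl, fun h => ?_⟩
      exact hpx (out.inj (congrArg (fun d => d.snd) h))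

/-- Besides its twin edge, `out p` has an edge to a successor of `p` and `inn p` one to a
predecessor, so the core has minimum degree two. -/
theorem exists_ne_fst_eq (hdeg : ∀ p, (∃ x, X.Step p x) ∧ ∃ x, X.Step x p) (d : X.graph.Dart)
    (hd : IsInner (core P L) d) : ∃ z, IsInner (core P L) z ∧ z.fst = d.fst ∧ z ≠ d := by
  obtain ⟨p, x, h, rfl | rfl⟩ := X.isInner_cases d hd
  · obtain ⟨y, hy, hyx⟩ : ∃ y, X.Link p y ∧ y ≠ x := by
      by_cases hpx : p = x
      · obtain ⟨y, hy⟩ := (hdeg p).1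
        refine ⟨y, .inr hy, ?_⟩
        rintro rfl
        subst hpx
        exact X.step_irrefl p hy
      · exact ⟨p, .inl rfl, hpx⟩
    refine ⟨X.linkDart hy, X.isInner_linkDart hy, rfl, fun h => ?_⟩
    exact hyx (inn.inj (congrArg (fun d => d.snd) h))
  · obtain ⟨y, hy, hyp⟩ : ∃ y, X.Link y x ∧ y ≠ p := by
      by_cases hpx : x = p
      · obtain ⟨y, hy⟩ := (hdeg x).2
        refine ⟨y, .inr hy, ?_⟩
        rintro rfl
        subst hpx
        exact X.step_irrefl x hy
      · exact ⟨x, .inl rfl, hpx⟩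
    refine ⟨(X.linkDart hy).symm, (X.isInner_linkDart hy).symm, rfl, fun h => ?_⟩
    exact hyp (out.inj (congrArg (fun d => d.snd) h))

section Counting

variable [Fintype P] [Fintype L]

open Classical in
/-- The pairs of points that are joined by an edge. -/
noncomputable def links : Finset (P × P) := Finset.univ.filter fun x => X.Link x.1 x.2

omit [Fintype L] in
theorem mem_links (x : P × P) : x ∈ X.links ↔ X.Link x.1 x.2 := by
  simp [links]

/-- Besides the core edges, every line contributes its two terminal edges. In Euler's formula these
cancel against the terminals. -/
theorem card_links_add_le : X.links.card + 2 * Fintype.card L ≤ X.graph.edgeSet.ncard := by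
  classical
  let g : (P × P) ⊕ (L ⊕ L) → Sym2 (Vert P L)
    | .inl x => s(out x.1, inn x.2)
    | .inr (.inl l) => s(src l, inn (X.pt l 0))
    | .inr (.inr l) => s(out (X.pt l q), tgt l)
  have hg : Function.Injective g := by
    rintro (⟨p, x⟩ | l | l) (⟨p', x'⟩ | l' | l') h <;> simp_all [g]
  have hsub : (((X.links.disjSum Finset.univ).image g : Finset _) : Set (Sym2 (Vert P L))) ⊆
      X.graph.edgeSet := by
    intro e he
    rw [Finset.mem_coe, Finset.mem_image] at he
    obtain ⟨⟨p, x⟩ | l | l, h, rfl⟩ := he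
    · rw [Finset.inl_mem_disjSum, mem_links, link_iff] at h
      exact h
    · exact X.start_adj l
    · exact X.stop_adj l
  have := Set.ncard_le_ncard hsub (Set.toFinite _)
  rw [Set.ncard_coe_finset, Finset.card_image_of_injective _ hg, Finset.card_disjSum,
    Finset.card_univ, Fintype.card_sum] at this
  omega

/-- These are the twin edges and the q steps on each line; steps on different lines are different
because two points determine a line. -/
theorem card_add_le_card_links : Fintype.card P + q * Fintype.card L ≤ X.links.card := by
  classical
  let g : P ⊕ (L × Fin q) → P × P
    | .inl p => (p, p)
    | .inr (l, i) => (X.pt l i, X.pt l (i + 1))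
  have hne : ∀ (l : L) (i : Fin q), X.pt l i ≠ X.pt l (i + 1) := by
    intro l i h
    have := X.pt_inj l i (i + 1) (by omega) (by omega) h
    omega
  have hg : Function.Injective g := by
    rintro (p | ⟨l, i⟩) (p' | ⟨l', i'⟩) h <;> simp only [g, Prod.mk.injEq] at h
    · rw [h.1]
    · exact absurd (h.1.symm.trans h.2) (hne l' i')
    · exact absurd (h.1.trans h.2.symm) (hne l i)
    · obtain rfl := On.line_unique (hne l i) (X.on_pt l i.2.le) (X.on_pt l i.2)
        ⟨i', i'.2.le, h.1.symm⟩ ⟨i' + 1, i'.2, h.2.symm⟩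
      rw [Fin.ext (X.pt_inj l i i' i.2.le i'.2.le h.1)]
  have hsub : Finset.univ.image g ⊆ X.links := by
    intro x hx
    obtain ⟨p | ⟨l, i⟩, -, rfl⟩ := Finset.mem_image.1 hx
    · exact (X.mem_links _).2 (.inl rfl)
    · exact (X.mem_links _).2 (.inr ⟨l, i, i.2, rfl, rfl⟩)
  have := Finset.card_le_card hsub
  rw [Finset.card_image_of_injective _ hg, Finset.card_univ, Fintype.card_sum, Fintype.card_prod,
    Fintype.card_fin] at this
  linarith [mul_comm q (Fintype.card L)]

/-- A planar embedding has many faces. -/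
theorem card_links_add_two_le [Nonempty P] (R : RotationSystem X.graph) (hR : R.IsPlanar) :
    X.links.card + 2 ≤ R.numFaces + 2 * Fintype.card P := by
  unfold RotationSystem.IsPlanar at hR
  have hiso : {v : Vert P L | X.graph.neighborSet v = ∅} = ∅ := by
    rw [Set.eq_empty_iff_forall_notMem]
    intro v (hv : X.graph.neighborSet v = ∅)
    have : X.nb v 0 ∈ X.graph.neighborSet v := X.nb_adj v 0 (Nat.zero_le _)
    rw [hv] at this
    exact this
  rw [hiso, Set.ncard_empty, card_vert] at hR
  have hE := X.card_links_add_le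
  obtain ⟨p⟩ := ‹Nonempty P›
  have : Nonempty X.graph.ConnectedComponent := ⟨X.graph.connectedComponentMk (inn p)⟩
  have : Finite X.graph.ConnectedComponent := Quot.finite _
  -- Connectedness is not needed: more components only increase the number of faces in Euler's
  -- formula.
  have hc : 0 < Nat.card X.graph.ConnectedComponent := Nat.card_pos
  omega

/-- A weight on the pairs of joined points, as a weight on pairs of vertices. -/
def weight (W : P → P → ℕ) : Vert P L × Vert P L → ℕ
  | (out p, inn x) => W p x
  | (inn x, out p) => W p x
  | _ => 0

-- Every face contains an inner dart, so it suffices to bound the weight of faces from an inner dart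
-- on. The factor 2 counts the two darts of every core edge.
open Classical in
theorem mul_numFaces_le_sum (W : P → P → ℕ) (k : ℕ) (R : RotationSystem X.graph)
    (h : ∀ d : X.graph.Dart, IsInner (core P L) d → ∃ s : Finset X.graph.Dart,
      (∀ d' ∈ s, IsInner (core P L) d' ∧ R.facePerm.SameCycle d d') ∧
        k ≤ ∑ d' ∈ s, weight W d'.toProd) :
    k * R.numFaces ≤ 2 * ∑ x ∈ X.links, W x.1 x.2 := by
  have hfin : Finite X.graph.Dart := Finite.of_injective _ SimpleGraph.Dart.toProd_injective
  have : Fintype X.graph.Dart := Fintype.ofFinite _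
  let T : Finset X.graph.Dart := Finset.univ.filter fun d => IsInner (core P L) d
  have h1 : k * R.numFaces ≤ ∑ d ∈ T, weight W d.toProd := by
    refine mul_numFaces_le _ k T fun d => ?_
    obtain ⟨d₁, hd₁, hc⟩ := exists_isInner_sameCycle (R := R) X.dart_eq_of_notMem_core
      X.exists_isInner X.fst_or_snd_mem_core d
    obtain ⟨s, hs, hk⟩ := h d₁ hd₁
    exact ⟨s, fun d' hd' => by simpa [T] using (hs d' hd').1,
      fun d' hd' => hc.trans (hs d' hd').2, hk⟩
  let A := X.links.image fun x => ((out x.1, inn x.2) : Vert P L × Vert P L)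
  let B := X.links.image fun x => ((inn x.2, out x.1) : Vert P L × Vert P L)
  have hT : T.image (fun d => d.toProd) ⊆ A ∪ B := by
    intro y hy
    obtain ⟨d, hd, rfl⟩ := Finset.mem_image.1 hy
    obtain ⟨p, x, hl, rfl | rfl⟩ := X.isInner_cases d (Finset.mem_filter.1 hd).2
    · exact Finset.mem_union_left _ (Finset.mem_image.2 ⟨(p, x), (X.mem_links _).2 hl, rfl⟩)
    · exact Finset.mem_union_right _ (Finset.mem_image.2 ⟨(p, x), (X.mem_links _).2 hl, rfl⟩)
  have hA : ∑ y ∈ A, weight W y = ∑ x ∈ X.links, W x.1 x.2 := by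
    refine Finset.sum_image ?_
    rintro ⟨p, x⟩ - ⟨p', x'⟩ - h
    simpa using h
  have hB : ∑ y ∈ B, weight W y = ∑ x ∈ X.links, W x.1 x.2 := by
    refine Finset.sum_image ?_
    rintro ⟨p, x⟩ - ⟨p', x'⟩ - h
    simpa [and_comm] using h
  have h2 : ∑ d ∈ T, weight W d.toProd = ∑ y ∈ T.image (fun d => d.toProd), weight W y :=
    (Finset.sum_image fun _ _ _ _ h => SimpleGraph.Dart.toProd_injective h).symm
  have h3 := Finset.sum_le_sum_of_subset (f := weight W) hT
  have h4 := Finset.sum_union_inter (s₁ := A) (s₂ := B) (f := weight W)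
  omega

/-- The graph of a projective plane of order at least three is not planar. -/
theorem not_isPlanarGraph_of_three_le (hq : 3 ≤ q) [Nonempty P]
    (hPL : Fintype.card P = Fintype.card L) : ¬ IsPlanarGraph X.graph := by
  classical
  rintro ⟨R, hR⟩
  have h1 := X.card_links_add_two_le R hR
  have h2 := X.card_add_le_card_links
  have h3 : 4 * R.numFaces ≤ 2 * ∑ x ∈ X.links, 1 := by
    refine X.mul_numFaces_le_sum (fun _ _ => 1) 4 R fun d hd => ?_
    obtain ⟨s, hs, hs'⟩ := exists_four_sameCycle (R := R) X.dart_eq_of_notMem_core IsInn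
      X.isInn_iff (X.exists_ne_of_isInner (by omega)) d hd
    · refine ⟨s, hs', ?_⟩
      have : ∀ d' ∈ s, 1 ≤ weight (fun _ _ => 1) d'.toProd := by
        intro d' hd'
        obtain ⟨p, x, h, rfl | rfl⟩ := X.isInner_cases d' (hs' d' hd').1 <;> exact le_rfl
      have := Finset.sum_le_sum this
      rwa [Finset.sum_const, hs] at this
  rw [Finset.sum_const, smul_eq_mul] at h3
  -- With m core edges, planarity gives m + 2 ≤ m / 2 + 2|P|, so m ≤ 4|P| - 4, whereas m ≥ |P| +
  -- 3|L| = 4|P|.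
  have : 3 * Fintype.card L ≤ q * Fintype.card L := Nat.mul_le_mul_right _ hq
  omega

/-- The edge from `p` to `x` lies on a cycle of length four. -/
def IsQuad (p x : P) : Prop :=
  ∃ p' x', p' ≠ p ∧ x' ≠ x ∧ X.Link p' x ∧ X.Link p' x' ∧ X.Link p x'

open Classical in
/-- If every point has a successor and a predecessor on some line, and if few edges lie on cycles
of length four, then the graph is not planar. -/
theorem not_isPlanarGraph_of_isQuad [Nonempty P]
    (hdeg : ∀ p, (∃ x, X.Step p x) ∧ ∃ x, X.Step x p)
    (hsum : ∑ x ∈ X.links, (if X.IsQuad x.1 x.2 then 3 else 2) + 12 * Fintype.card P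
      < 6 * X.links.card + 12) : ¬ IsPlanarGraph X.graph := by
  rintro ⟨R, hR⟩
  have h1 := X.card_links_add_two_le R hR
  let W : P → P → ℕ := fun p x => if X.IsQuad p x then 3 else 2
  -- The weights are balanced so that six darts of weight at least 2 and four darts of weight 3 both
  -- give 12.
  have h3 : 12 * R.numFaces ≤ 2 * ∑ x ∈ X.links, W x.1 x.2 := by
    refine X.mul_numFaces_le_sum W 12 R fun d hd => ?_
    obtain ⟨s, hs', hs⟩ := exists_six_sameCycle (R := R) X.dart_eq_of_notMem_core IsInn
      X.isInn_iff (X.exists_ne_fst_eq hdeg) d hd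
    · refine ⟨s, hs', ?_⟩
      rcases hs with hs | ⟨hs, hquad⟩
      · have : ∀ d' ∈ s, 2 ≤ weight W d'.toProd := by
          intro d' hd'
          have hW : ∀ p x, 2 ≤ W p x := by
            intro p x
            simp only [W]
            split_ifs <;> omega
          obtain ⟨p, x, h, rfl | rfl⟩ := X.isInner_cases d' (hs' d' hd').1 <;> exact hW _ _
        have := Finset.sum_le_sum this
        rwa [Finset.sum_const, hs] at this
      · have : ∀ d' ∈ s, 3 ≤ weight W d'.toProd := by
          intro d' hd'
          obtain ⟨u, v, hu, hv, hu', hv', a1, a2, a3⟩ := hquad d' hd'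
          obtain ⟨p, x, h, rfl | rfl⟩ := X.isInner_cases d' (hs' d' hd').1
          · obtain ⟨p', rfl | rfl⟩ := hu'
            · exact absurd a1 (by simp [linkDart, graph_adj, Arc])
            obtain ⟨x', rfl | rfl⟩ := hv'
            · exact (if_pos ⟨p', x', fun h => hu (by rw [h]; rfl), fun h => hv (by rw [h]; rfl),
                (X.link_iff _ _).2 a1, (X.link_iff _ _).2 a2, (X.link_iff _ _).2 a3⟩ :
                  W p x = 3).ge
            · exact absurd a2 (by simp [graph_adj, Arc])
          · obtain ⟨x', rfl | rfl⟩ := hu'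
            · obtain ⟨p', rfl | rfl⟩ := hv'
              · exact absurd a2 (by simp [graph_adj, Arc])
              exact (if_pos ⟨p', x', fun h => hv (by rw [h]; rfl), fun h => hu (by rw [h]; rfl),
                (X.link_iff _ _).2 a3.symm, (X.link_iff _ _).2 a2.symm,
                (X.link_iff _ _).2 a1.symm⟩ : W p x = 3).ge
            · exact absurd a1 (by simp [linkDart, graph_adj, Arc])
        have := Finset.sum_le_sum this
        rwa [Finset.sum_const, hs] at this
  simp only [W] at h3
  omega

end Counting

end OrderedPlane

/-! ### The case q = 2: a suitably ordered Fano plane. -/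

namespace OrderedPlane

section Fano

/-- The points on the lines of the Fano plane, in an order for which few pairs of successors span
a cycle of length four. -/
def fanoPt : Fin 7 → Fin 3 → Fin 7 :=
  ![![0, 1, 3], ![1, 2, 4], ![2, 3, 5], ![3, 6, 4], ![4, 5, 0], ![6, 1, 5], ![2, 0, 6]]

/-- The lines through the points of the Fano plane. -/
def fanoLn : Fin 7 → Fin 3 → Fin 7 :=
  ![![0, 4, 6], ![0, 1, 5], ![1, 2, 6], ![0, 2, 3], ![1, 3, 4], ![2, 4, 5], ![3, 5, 6]]

theorem exists_le_two (Q : ℕ → Prop) :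
    (∃ i ≤ 2, Q i) ↔ ∃ i : Fin 3, Q i := by
  constructor
  · rintro ⟨i, hi, h⟩
    exact ⟨⟨i, by omega⟩, h⟩
  · rintro ⟨i, h⟩
    exact ⟨i, by omega, h⟩

/-- The Fano plane. -/
def fano : OrderedPlane 2 (Fin 7) (Fin 7) where
  pt l i := fanoPt l (Fin.ofNat 3 i)
  ln p i := fanoLn p (Fin.ofNat 3 i)
  pt_inj l i j hi hj h := by
    have key : ∀ l, Function.Injective (fanoPt l) := by decide
    have := congrArg Fin.val (key l h)
    simp only [Fin.ofNat] at this
    omega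
  ln_inj l i j hi hj h := by
    have key : ∀ l, Function.Injective (fanoLn l) := by decide
    have := congrArg Fin.val (key l h)
    simp only [Fin.ofNat] at this
    omega
  incident := by
    simp only [exists_le_two]
    decide +kernel
  exists_line := by
    simp only [exists_le_two]
    decide +kernel
  exists_point := by
    simp only [exists_le_two]
    decide +kernel
  eq_or_eq := by
    simp only [exists_le_two]
    decide +kernel

/-- Whether `x` is equal to `p` or a successor of `p` in the Fano plane. -/
def fanoLink (p x : Fin 7) : Bool :=
  decide (x = p ∨ ∃ l, ∃ i : Fin 2, fanoPt l i.castSucc = p ∧ fanoPt l i.succ = x)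

theorem fano_step_iff (p x : Fin 7) : fano.Step p x ↔
    ∃ l, ∃ i : Fin 2, fanoPt l i.castSucc = p ∧ fanoPt l i.succ = x := by
  constructor
  · rintro ⟨l, i, hi, h⟩
    refine ⟨l, ⟨i, hi⟩, ?_⟩
    interval_cases i <;> exact h
  · rintro ⟨l, i, h⟩
    refine ⟨l, i, i.2, ?_⟩
    fin_cases i <;> exact h

theorem fano_link_iff (p x : Fin 7) : fano.Link p x ↔ fanoLink p x = true := by
  rw [fanoLink, decide_eq_true_eq, ← fano_step_iff]
  rfl

theorem fano_isQuad_iff (p x : Fin 7) : fano.IsQuad p x ↔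
    ∃ p' x', p' ≠ p ∧ x' ≠ x ∧ fanoLink p' x = true ∧ fanoLink p' x' = true ∧
      fanoLink p x' = true := by
  simp only [IsQuad, fano_link_iff]

theorem fano_links : fano.links = Finset.univ.filter fun x => fanoLink x.1 x.2 = true := by
  ext x
  rw [mem_links, fano_link_iff, Finset.mem_filter]
  simp

theorem not_isPlanarGraph_fano : ¬ IsPlanarGraph fano.graph := by
  refine fano.not_isPlanarGraph_of_isQuad ?_ ?_
  · simp only [fano_step_iff]
    decide +kernel
  · simp only [fano_links, fano_isQuad_iff]
    -- There are 21 core edges, of which 11 lie on four-cycles: 2 · 21 + 11 = 53. The required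
    -- inequality 53 + 84 < 126 + 12 holds with nothing to spare.
    have h1 : ∑ x ∈ Finset.univ.filter (fun x : Fin 7 × Fin 7 => fanoLink x.1 x.2 = true),
        (if ∃ p' x', p' ≠ x.1 ∧ x' ≠ x.2 ∧ fanoLink p' x.2 = true ∧ fanoLink p' x' = true ∧
          fanoLink x.1 x' = true then 3 else 2) = 53 := by
      decide +kernel
    have h2 : (Finset.univ.filter
        (fun x : Fin 7 × Fin 7 => fanoLink x.1 x.2 = true)).card = 21 := by
      decide +kernel
    rw [h2, Fintype.card_fin]
    refine lt_of_le_of_lt (Nat.add_le_add_right (le_of_eq ?_) _) (by norm_num : 53 + 12 * 7 < _)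
    rw [← h1]

end Fano

/-! ### Planes over finite fields, and the choice of the plane for each q. -/

open Configuration in
/-- The points and lines of a finite projective plane can be enumerated. -/
theorem exists_of_projectivePlane (P L : Type) [Membership P L] [ProjectivePlane P L]
    [Finite P] [Finite L] : Nonempty (OrderedPlane (ProjectivePlane.order P L) P L) := by
  classical
  set q := ProjectivePlane.order P L
  have e : ∀ l : L, Nonempty ({p : P // p ∈ l} ≃ Fin (q + 1)) := fun l =>
    ⟨Finite.equivFinOfCardEq (ProjectivePlane.pointCount_eq P l)⟩
  have f : ∀ p : P, Nonempty ({l : L // p ∈ l} ≃ Fin (q + 1)) := fun p =>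
    ⟨Finite.equivFinOfCardEq (ProjectivePlane.lineCount_eq L p)⟩
  let e' := fun l => (e l).some
  let f' := fun p => (f p).some
  have he : ∀ (p : P) (l : L),
      (∃ i ≤ q, ((e' l).symm (Fin.ofNat (q + 1) i) : P) = p) ↔ p ∈ l := by
    intro p l
    constructor
    · rintro ⟨i, -, rfl⟩
      exact Subtype.prop _
    · intro h
      refine ⟨e' l ⟨p, h⟩, by omega, ?_⟩
      rw [Fin.ofNat_val_eq_self, Equiv.symm_apply_apply]
  have hf : ∀ (p : P) (l : L),
      (∃ i ≤ q, ((f' p).symm (Fin.ofNat (q + 1) i) : L) = l) ↔ p ∈ l := by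
    intro p l
    constructor
    · rintro ⟨i, -, rfl⟩
      exact ((f' p).symm _).2
    · intro h
      refine ⟨f' p ⟨l, h⟩, by omega, ?_⟩
      rw [Fin.ofNat_val_eq_self, Equiv.symm_apply_apply]
  have inj : ∀ i j : ℕ, i ≤ q → j ≤ q → Fin.ofNat (q + 1) i = Fin.ofNat (q + 1) j → i = j := by
    intro i j hi hj h
    have := congrArg Fin.val h
    rwa [Fin.val_ofNat, Fin.val_ofNat, Nat.mod_eq_of_lt (by omega),
      Nat.mod_eq_of_lt (by omega)] at this
  exact ⟨{
    pt := fun l i => (e' l).symm (Fin.ofNat (q + 1) i)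
    ln := fun p i => (f' p).symm (Fin.ofNat (q + 1) i)
    pt_inj := fun l i j hi hj h =>
      inj i j hi hj ((e' l).symm.injective (Subtype.ext h))
    ln_inj := fun p i j hi hj h =>
      inj i j hi hj ((f' p).symm.injective (Subtype.ext h))
    incident := fun p l => (he p l).trans (hf p l).symm
    exists_line := fun p p' h => by
      simp only [he]
      exact ⟨HasLines.mkLine h, HasLines.mkLine_ax h⟩
    exists_point := fun l l' h => by
      simp only [he]
      exact ⟨HasPoints.mkPoint h, HasPoints.mkPoint_ax h⟩
    eq_or_eq := fun p p' l l' => by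
      simp only [he]
      exact Nondegenerate.eq_or_eq }⟩

open Configuration LinearAlgebra.Projectivization in
/-- For every prime power `q` there is a projective plane of order `q`. -/
theorem exists_of_isPrimePow (q : ℕ) (hq : IsPrimePow q) :
    ∃ (P L : Type) (_ : Fintype P) (_ : Fintype L) (_ : OrderedPlane q P L),
      Fintype.card P = q ^ 2 + q + 1 ∧ Fintype.card L = q ^ 2 + q + 1 := by
  classical
  obtain ⟨p, k, hp, hk, rfl⟩ := (isPrimePow_nat_iff q).1 hq
  have : Fact p.Prime := ⟨hp⟩
  let K := GaloisField p k
  have hK : Nat.card K = p ^ k := GaloisField.card p k hk.ne'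
  have hcard : Nat.card (ℙ K (Fin 3 → K)) = (p ^ k) ^ 2 + p ^ k + 1 := by
    rw [Projectivization.card_of_finrank K (Fin 3 → K) (n := 3) (by simp), hK]
    simp only [Finset.sum_range_succ, Finset.range_zero, Finset.sum_empty]
    ring
  have : Fintype (ℙ K (Fin 3 → K)) := Fintype.ofFinite _
  rw [Nat.card_eq_fintype_card] at hcard
  -- Points and lines are both represented by the points of the projective plane over `K`, with
  -- orthogonality as incidence.
  obtain ⟨X⟩ := exists_of_projectivePlane (ℙ K (Fin 3 → K)) (ℙ K (Fin 3 → K))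
  have hord : ProjectivePlane.order (ℙ K (Fin 3 → K)) (ℙ K (Fin 3 → K)) = p ^ k := by
    have h := ProjectivePlane.card_points (ℙ K (Fin 3 → K)) (ℙ K (Fin 3 → K))
    rw [hcard] at h
    nlinarith
  rw [hord] at X
  exact ⟨_, _, _, _, X, hcard, hcard⟩

/-- For every prime power `q` there is a projective plane of order `q` with a nonplanar graph. -/
theorem exists_not_isPlanarGraph (q : ℕ) (hq : IsPrimePow q) :
    ∃ (P L : Type) (_ : Fintype P) (_ : Fintype L) (X : OrderedPlane q P L),
      Fintype.card P = q ^ 2 + q + 1 ∧ Fintype.card L = q ^ 2 + q + 1 ∧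
        ¬ IsPlanarGraph X.graph := by
  obtain rfl | h3 : q = 2 ∨ 3 ≤ q := by
    have := hq.one_lt
    omega
  · exact ⟨Fin 7, Fin 7, inferInstance, inferInstance, fano, rfl, rfl, not_isPlanarGraph_fano⟩
  · obtain ⟨P, L, _, _, X, hP, hL⟩ := exists_of_isPrimePow q hq
    have : Nonempty P := Fintype.card_pos_iff.1 (by omega)
    exact ⟨P, L, _, _, X, hP, hL, X.not_isPlanarGraph_of_three_le h3 (hP.trans hL.symm)⟩

end OrderedPlane

theorem mainTheorem2 :
    ∃ c : ℝ, 0 < c ∧ ∀ q : ℕ, IsPrimePow q →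
      ∃ (V L : Type) (_ : Fintype V) (_ : Fintype L) (M : LineNetwork V L),
        M.PathTerminal ∧ M.PathIntersection ∧ ¬ IsPlanarGraph M.graph ∧
        -- the lines and the edges with at least two lines form a Steiner system
        Fintype.card L = q ^ 2 + q + 1 ∧ M.multiEdges.ncard = q ^ 2 + q + 1 ∧
        (∀ l : L, {e | e ∈ M.multiEdges ∧ l ∈ M.linesOn e}.ncard = q + 1) ∧
        (∀ e ∈ M.multiEdges, ∀ e' ∈ M.multiEdges, e ≠ e' →
          ∃! l : L, l ∈ M.linesOn e ∧ l ∈ M.linesOn e') ∧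
        -- every solution has many block crossings
        (∀ S : M.LineOrders, S.Consistent →
          c * ((Fintype.card L : ℝ) * √(M.multiEdges.ncard : ℝ)) ≤ (S.blockCrossings : ℝ)) ∧
        -- there are solutions, even monotone ones, of that order of magnitude
        (∃ S : M.LineOrders, S.Consistent ∧ S.Monotone ∧
          (S.blockCrossings : ℝ) ≤ (Fintype.card L : ℝ) * √(M.multiEdges.ncard : ℝ)) := by
  -- The constant combines the factor 1/3 from the three seams of a block move with √(q² + q + 1) ≤
  -- 2q.
  refine ⟨1 / 6, by norm_num, fun q hq => ?_⟩
  obtain ⟨P, L, _, _, X, hP, hL, hplanar⟩ := OrderedPlane.exists_not_isPlanarGraph q hq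
  have hq1 : 1 ≤ q := hq.one_lt.le
  have hq1' : (1 : ℝ) ≤ q := by exact_mod_cast hq1
  have hE : X.network.multiEdges.ncard = q ^ 2 + q + 1 := (X.ncard_multiEdges hq1).trans hP
  refine ⟨OrderedPlane.Vert P L, L, inferInstance, inferInstance, X.network, X.pathTerminal,
    X.pathIntersection, hplanar, hL, hE, X.ncard_multiEdges_line hq1, X.existsUnique_line hq1,
    fun S hS => ?_, X.solution hq1, X.consistent_solution hq1, X.monotone_solution hq1, ?_⟩
  · have h := OrderedPlane.le_blockCrossings S hS
    rw [hP] at h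
    have h' : ((q ^ 2 + q + 1 : ℕ) : ℝ) * q ≤ 3 * S.blockCrossings := by exact_mod_cast h
    have hsqrt : √((q ^ 2 + q + 1 : ℕ) : ℝ) ≤ 2 * q := by
      rw [Real.sqrt_le_left (by positivity)]
      push_cast
      nlinarith
    rw [hL, hE]
    have := mul_le_mul_of_nonneg_left hsqrt (Nat.cast_nonneg (α := ℝ) (q ^ 2 + q + 1))
    linarith
  · rw [X.blockCrossings_solution hq1, hP, hL, hE, Nat.cast_mul]
    refine mul_le_mul_of_nonneg_left (Real.le_sqrt_of_sq_le ?_) (Nat.cast_nonneg _)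
    push_cast
    nlinarith
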